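/- Let $k,p\ge 1$ and, for $j=1,\dots,k$, let $x_{j1},x_{j2},\dots$ be a sequence of row vectors in $\mathbb R^{m_j}$. For a sample size $n$ let $X_j=X_j^{(n)}$ be the $n\times m_j$ design matrix with rows $x_{j1},\dots,x_{jn}$ (so new observations add new rows and leave the earlier rows intact), let $Z_j$ be a fixed $p\times q_j$ profile matrix of full column rank, and let $\Theta_j$ be an $m_j\times q_j$ matrix of coefficients. Suppose that for all sufficiently large $n$ each $X_j$ has full column rank, $\operatorname{rank}(X_j)+p\le n$, and $X_i'X_j=0$ for $i\ne j$. Consider the additive growth curve model $$Y_n=\sum_{j=1}^k X_j\Theta_jZ_j'+\mathcal E_n ,$$ where the rows of $\mathcal E_n$ are the first $n$ terms of a sequence of i.i.d. random vectors in $\mathbb R^p$ with mean zero and positive definite covariance matrix $\Sigma$. Put $$\widehat\Sigma(Y)=Y'WY,\qquad W=\frac1r\Bigl(I-\sum_{j=1}^kX_j(X_j'X_j)^{-1}X_j'\Bigr),\qquad r=n-\sum_{j=1}^k\operatorname{rank}(X_j),$$ and, where $\widehat\Sigma(Y)$ is positive definite, let $(\widehat\Theta_1(Y),\dots,\widehat\Theta_k(Y))$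 be the two-stage generalized least-squares estimator, i.e. the minimizer over $(T_1,\dots,T_k)$ of $\operatorname{tr}\bigl(w\,\widehat\Sigma(Y)^{-1}w'\bigr)$ with $w=Y-\sum_jX_jT_jZ_j'$ (with an arbitrary fixed value, say $0$, elsewhere). Assume that for every $j$, $n^{-1}X_j'X_j$ converges, as $n\to\infty$, to a positive definite matrix $R_j$. Fix $i$, and let $C$ and $V$ be constant $s\times m_i$ and $t\times q_i$ matrices such that $C(X_i'X_i)^{-1}C'$ is nonsingular for all sufficiently large $n$ and $V(Z_i'\widehat\Sigma^{-1}(Y_n)Z_i)^{-1}V'$ is nonsingular with probability tending to one (for instance almost surely for all large $n$). If $\mathrm H_i:\ C\Theta_iV'=0$ holds, then $$\bigl(C\,n(X_i'X_i)^{-1}C'\bigr)^{-1/2}\,\sqrt n\,C\widehat\Theta_i(Y_n)V'\,\bigl(V(Z_i'\widehat\Sigma^{-1}(Y_n)Z_i)^{-1}V'\bigr)^{-1/2}$$ converges in distribution, as $n\to\infty$, to $\mathcal N_{s\times t}(0,I)$, the law of an $s\times t$ matrix with independent standard normal entries. Here $A^{-1/2}$ denotes the inverse of the symmetric positive semidefinite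 square root of $A$. -/

import Mathlib

open MeasureTheory ProbabilityTheory Filter Topology

namespace GrowthCurve

/-- Data matrix of the first `n` individuals: its rows are the first `n` terms of a sequence of
row vectors, so that increasing `n` adds new rows and leaves the earlier rows intact. -/
def firstRows {d : ℕ} (x : ℕ → Fin d → ℝ) (n : ℕ) : Matrix (Fin n) (Fin d) ℝ :=
  Matrix.of fun l => x l

section Model

variable {k n p : ℕ} {m q : Fin k → ℕ}

/-- The mean structure `∑ⱼ Xⱼ Θⱼ Zⱼ'`. -/
def meanStructure (X : ∀ j, Matrix (Fin n) (Fin (m j)) ℝ) (Z : ∀ j, Matrix (Fin p) (Fin (q j)) ℝ)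
    (Θ : ∀ j, Matrix (Fin (m j)) (Fin (q j)) ℝ) : Matrix (Fin n) (Fin p) ℝ :=
  ∑ j, X j * Θ j * (Z j).transpose

/-- The conditions on the design matrices: full (column) rank, `rank Xⱼ + p ≤ n`, and mutually
orthogonal column spaces. -/
structure IsOrthogonalDesign (p : ℕ) (X : ∀ j, Matrix (Fin n) (Fin (m j)) ℝ) : Prop where
  rank_eq : ∀ j, (X j).rank = m j
  rank_add_le : ∀ j, (X j).rank + p ≤ n
  orthogonal : ∀ i j, i ≠ j → (X i).transpose * X j = 0

/-- `X (X'X)⁻¹ X'`, the orthogonal projection onto the column space of a matrix `X` of full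
column rank. -/
noncomputable def colProj {d : ℕ} (X : Matrix (Fin n) (Fin d) ℝ) : Matrix (Fin n) (Fin n) ℝ :=
  X * (X.transpose * X)⁻¹ * X.transpose

/-- The quadratic covariance estimator `Σ̂(Y) = Y' W Y`, where `W = (1/r) (I - ∑ⱼ P_{Xⱼ})` and
`r = n - ∑ⱼ rank Xⱼ`. -/
noncomputable def covEstimator (X : ∀ j, Matrix (Fin n) (Fin (m j)) ℝ)
    (Y : Matrix (Fin n) (Fin p) ℝ) : Matrix (Fin p) (Fin p) ℝ :=
  Y.transpose * (((n : ℝ) - ∑ j, ((X j).rank : ℝ))⁻¹ • (1 - ∑ j, colProj (X j))) * Y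

/-- The squared norm `vec(w)' (I ⊗ S)⁻¹ vec(w) = tr (w S⁻¹ w')`, i.e. the sum of `wₗ' S⁻¹ wₗ` over
the rows `wₗ'` of `w`. -/
noncomputable def glsNormSq (S : Matrix (Fin p) (Fin p) ℝ) (w : Matrix (Fin n) (Fin p) ℝ) : ℝ :=
  (w * S⁻¹ * w.transpose).trace

/-- `T = (T₁, …, T_k)` is a value of the two-stage generalized least-squares estimator at the
observation `Y`: the first-stage estimate `Σ̂(Y)` is positive definite, and the GLS criterion in
which the unknown covariance is replaced by `Σ̂(Y)` is minimal at `T`. -/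
def IsTwoStageGLS (X : ∀ j, Matrix (Fin n) (Fin (m j)) ℝ)
    (Z : ∀ j, Matrix (Fin p) (Fin (q j)) ℝ) (Y : Matrix (Fin n) (Fin p) ℝ)
    (T : ∀ j, Matrix (Fin (m j)) (Fin (q j)) ℝ) : Prop :=
  (covEstimator X Y).PosDef ∧
    ∀ T' : ∀ j, Matrix (Fin (m j)) (Fin (q j)) ℝ,
      glsNormSq (covEstimator X Y) (Y - meanStructure X Z T) ≤
        glsNormSq (covEstimator X Y) (Y - meanStructure X Z T')

open Classical in
/-- The two-stage GLS estimator `(Θ̂₁(Y), …, Θ̂_k(Y))` of the regression coefficients: the minimizer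
of the two-stage GLS criterion (set to zero for observations at which there is none, for example
where `Σ̂(Y)` is singular). -/
noncomputable def twoStageGLS (X : ∀ j, Matrix (Fin n) (Fin (m j)) ℝ)
    (Z : ∀ j, Matrix (Fin p) (Fin (q j)) ℝ) (Y : Matrix (Fin n) (Fin p) ℝ) :
    ∀ j, Matrix (Fin (m j)) (Fin (q j)) ℝ :=
  if h : ∃ T, IsTwoStageGLS X Z Y T then h.choose else 0

end Model

open scoped MatrixOrder in
/-- `A^{-1/2}`: the inverse of the symmetric positive semidefinite square root of `A`. -/
noncomputable def invSqrt {d : ℕ} (A : Matrix (Fin d) (Fin d) ℝ) : Matrix (Fin d) (Fin d) ℝ :=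
  (CFC.sqrt A)⁻¹

/-- The vector of all entries of a matrix, its rows stacked one underneath another. -/
def vecRows {s t : ℕ} (A : Matrix (Fin s) (Fin t) ℝ) : EuclideanSpace ℝ (Fin s × Fin t) :=
  WithLp.toLp 2 fun ab => A ab.1 ab.2

section Statistic

variable {k n p s t : ℕ} {m q : Fin k → ℕ}

/-- `C (X'X)⁻¹ C'`. -/
noncomputable def designForm {d : ℕ} (C : Matrix (Fin s) (Fin d) ℝ)
    (X : Matrix (Fin n) (Fin d) ℝ) : Matrix (Fin s) (Fin s) ℝ :=
  C * (X.transpose * X)⁻¹ * C.transpose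

/-- `V (Z' S⁻¹ Z)⁻¹ V'`. -/
noncomputable def profileForm {d : ℕ} (V : Matrix (Fin t) (Fin d) ℝ)
    (Z : Matrix (Fin p) (Fin d) ℝ) (S : Matrix (Fin p) (Fin p) ℝ) : Matrix (Fin t) (Fin t) ℝ :=
  V * (Z.transpose * S⁻¹ * Z)⁻¹ * V.transpose

/-- The standardized statistic
`(C n(Xᵢ'Xᵢ)⁻¹ C')^{-1/2} √n C Θ̂ᵢ(Y) V' (V (Zᵢ' Σ̂(Y)⁻¹ Zᵢ)⁻¹ V')^{-1/2}`. -/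
noncomputable def standardizedStatistic (X : ∀ j, Matrix (Fin n) (Fin (m j)) ℝ)
    (Z : ∀ j, Matrix (Fin p) (Fin (q j)) ℝ) (i : Fin k) (C : Matrix (Fin s) (Fin (m i)) ℝ)
    (V : Matrix (Fin t) (Fin (q i)) ℝ) (Y : Matrix (Fin n) (Fin p) ℝ) :
    Matrix (Fin s) (Fin t) ℝ :=
  invSqrt ((n : ℝ) • designForm C (X i)) *
    (√(n : ℝ) • (C * twoStageGLS X Z Y i * V.transpose)) *
    invSqrt (profileForm V (Z i) (covEstimator X Y))

end Statistic

end GrowthCurve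

/-! Orthogonality of the designs decouples the normal equations: when `Σ̂` is positive definite the
estimator is unique and its `i`-th block is `(Xᵢ'Xᵢ)⁻¹ Xᵢ' Y Σ̂⁻¹ Zᵢ (Zᵢ' Σ̂⁻¹ Zᵢ)⁻¹`
(`twoStageGLS_of_posDef`). The residual projection kills the mean structure, so `Σ̂` depends on the
errors alone, and under `C Θᵢ V' = 0` the mean drops out of the numerator too. The statistic is
therefore exactly a product `Wₙ (E S^{-1/2}) Q(Σ̂)` (`standardizedStatistic_eq`), with deterministic
weights `Wₙ` and with `Q` the `profileFactor`.

The middle part `Wₙ E S^{-1/2}` is a weighted sum of i.i.d. standardized vectors. Here `Wₙ Wₙ' → I`,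
and the columns of `Wₙ` are uniformly small, because convergence of `n⁻¹ X'X` for nested designs
forces the rows to be `o(√n)` uniformly. A characteristic function argument
(`tendstoInDistribution_weighted_sum`) gives a standard normal `s × p` limit `G`.

The estimate `Σ̂` is consistent (`tendstoInProb_covEstimator`), so `Q(Σ̂) → Q(S)` in probability. By
Slutsky the product tends in law to `G Q(S)`; no independence of the two factors is needed, as the
second limit is constant. Finally `Q(S)' Q(S) = I`, and right multiplication by such a matrix turns
a standard normal matrix into a standard normal one. -/

namespace GrowthCurve

/-! ### Continuity and measurability of the matrix square root and inverse. -/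

section MatrixAnalysis

open scoped MatrixOrder

instance instMeasurableSpaceMatrix {a b : ℕ} : MeasurableSpace (Matrix (Fin a) (Fin b) ℝ) :=
  inferInstanceAs (MeasurableSpace (Fin a → Fin b → ℝ))

instance instBorelSpaceMatrix {a b : ℕ} : BorelSpace (Matrix (Fin a) (Fin b) ℝ) :=
  inferInstanceAs (BorelSpace (Fin a → Fin b → ℝ))

instance instSecondCountableMatrix {a b : ℕ} :
    SecondCountableTopology (Matrix (Fin a) (Fin b) ℝ) :=
  inferInstanceAs (SecondCountableTopology (Fin a → Fin b → ℝ))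

variable {d : ℕ}

lemma isClosed_posSemidef :
    IsClosed {A : Matrix (Fin d) (Fin d) ℝ | A.PosSemidef} := by
  simp only [Matrix.posSemidef_iff_dotProduct_mulVec, Matrix.IsHermitian, Set.ofPred_and,
    Set.ofPred_forall]
  refine (isClosed_eq (by fun_prop) continuous_id).inter (isClosed_iInter fun x => ?_)
  exact isClosed_le continuous_const (by fun_prop)

/-- For symmetric `B` the trace of `B²` is the sum of the squared entries. Applied to a square root,
this bounds its entries by the trace of the original matrix. -/
lemma abs_apply_le_of_mul_self_trace_le {B : Matrix (Fin d) (Fin d) ℝ} (hB : B.PosSemidef) {c : ℝ}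
    (hc : (B * B).trace ≤ c) (i j : Fin d) : |B i j| ≤ √c := by
  refine Real.abs_le_sqrt (le_trans ?_ hc)
  have hsym : ∀ a b, B b a = B a b := fun a b => by simpa using hB.isHermitian.apply a b
  simp only [Matrix.trace, Matrix.diag, Matrix.mul_apply]
  calc B i j ^ 2 ≤ ∑ b, B i b * B b i := by
        rw [sq]
        nth_rw 2 [← hsym i j]
        refine Finset.single_le_sum (f := fun b => B i b * B b i) (fun b _ => ?_) (Finset.mem_univ j)
        rw [hsym i b]; exact mul_self_nonneg _
    _ ≤ _ := by
        refine Finset.single_le_sum (f := fun a => ∑ b, B a b * B b a)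
          (fun a _ => Finset.sum_nonneg fun b _ => ?_) (Finset.mem_univ i)
        rw [hsym a b]; exact mul_self_nonneg _

lemma posSemidef_sqrt (A : Matrix (Fin d) (Fin d) ℝ) : (CFC.sqrt A).PosSemidef :=
  Matrix.nonneg_iff_posSemidef.1 (CFC.sqrt_nonneg A)

lemma sqrt_mul_sqrt {A : Matrix (Fin d) (Fin d) ℝ} (hA : A.PosSemidef) :
    CFC.sqrt A * CFC.sqrt A = A :=
  CFC.sqrt_mul_sqrt_self A hA.nonneg

lemma isCompact_abs_apply_le (c : ℝ) :
    IsCompact {B : Matrix (Fin d) (Fin d) ℝ | ∀ i j, |B i j| ≤ c} := by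
  have h : IsCompact (Set.univ.pi fun _ : Fin d => Set.univ.pi fun _ : Fin d => Set.Icc (-c) c) :=
    isCompact_univ_pi fun _ => isCompact_univ_pi fun _ => isCompact_Icc
  have heq : {B : Matrix (Fin d) (Fin d) ℝ | ∀ i j, |B i j| ≤ c} =
      (Set.univ.pi fun _ : Fin d => Set.univ.pi fun _ : Fin d => Set.Icc (-c) c :
        Set (Fin d → Fin d → ℝ)) := by
    exact Set.ext fun B => ⟨fun h i _ j _ => abs_le.1 (h i j),
      fun h i j => abs_le.2 (h i trivial j trivial)⟩
  rw [heq]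
  exact h

/-- The square root is continuous on positive semidefinite matrices. -/
lemma continuousOn_sqrt :
    ContinuousOn (fun A : Matrix (Fin d) (Fin d) ℝ => CFC.sqrt A) {A | A.PosSemidef} := by
  intro A hA
  have hpsd : ∀ᶠ B : Matrix (Fin d) (Fin d) ℝ in 𝓝[{A | A.PosSemidef}] A, B.PosSemidef :=
    eventually_mem_nhdsWithin
  -- Compactness and uniqueness: near `A` the roots stay in a compact set, and any cluster point is
  -- positive semidefinite with square `A`, hence is the root of `A`.
  refine (isCompact_abs_apply_le (√(A.trace + 1))).tendsto_nhds_of_unique_mapClusterPt ?_ ?_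
  · have htr : ∀ᶠ B : Matrix (Fin d) (Fin d) ℝ in 𝓝[{A | A.PosSemidef}] A,
        B.trace < A.trace + 1 :=
      nhdsWithin_le_nhds <| (Continuous.tendsto (by fun_prop : Continuous
        fun B : Matrix (Fin d) (Fin d) ℝ => B.trace) A).eventually (gt_mem_nhds (by linarith))
    filter_upwards [hpsd, htr] with B hB ht i j
    exact abs_apply_le_of_mul_self_trace_le (posSemidef_sqrt B) (by rw [sqrt_mul_sqrt hB]; exact ht.le) i j
  · intro z _ hz
    have hzpsd : z.PosSemidef :=
      isClosed_posSemidef.mem_of_mapClusterPt hz (Eventually.of_forall posSemidef_sqrt)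
    have hsq : MapClusterPt (z * z) (𝓝[{A | A.PosSemidef}] A)
        (fun B : Matrix (Fin d) (Fin d) ℝ => CFC.sqrt B * CFC.sqrt B) :=
      MapClusterPt.continuousAt_comp (f := fun B : Matrix (Fin d) (Fin d) ℝ => B * B)
        (Continuous.continuousAt (by fun_prop)) hz
    have hlim : Tendsto (fun B : Matrix (Fin d) (Fin d) ℝ => CFC.sqrt B * CFC.sqrt B)
        (𝓝[{A | A.PosSemidef}] A) (𝓝 A) :=
      (tendsto_nhdsWithin_of_tendsto_nhds tendsto_id).congr' <| by
        filter_upwards [hpsd] with B hB using (sqrt_mul_sqrt hB).symm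
    have hzA : z * z = A := by
      have : ClusterPt (z * z) (𝓝 A) := ClusterPt.mono hsq hlim
      by_contra hne
      exact (disjoint_iff.mp (disjoint_nhds_nhds.2 hne)) |> this.neBot.ne
    exact (CFC.sqrt_unique hzA hzpsd.nonneg).symm

/-- The functional calculus returns 0 outside its domain, which makes the root measurable on all
matrices. -/
lemma sqrt_eq_zero_of_not_posSemidef {A : Matrix (Fin d) (Fin d) ℝ} (hA : ¬ A.PosSemidef) :
    CFC.sqrt A = 0 := by
  rw [CFC.sqrt, cfcₙ_apply_of_not_predicate]
  exact fun h => hA (Matrix.nonneg_iff_posSemidef.1 h)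

lemma measurable_sqrt : Measurable fun A : Matrix (Fin d) (Fin d) ℝ => CFC.sqrt A := by
  classical
  have h := (continuousOn_sqrt (d := d)).measurable_piecewise
    (continuousOn_const (c := (0 : Matrix (Fin d) (Fin d) ℝ))) isClosed_posSemidef.measurableSet
  convert h using 1
  ext1 A
  by_cases hA : A.PosSemidef
  · simp [Set.piecewise, hA]
  · simp [Set.piecewise, hA, sqrt_eq_zero_of_not_posSemidef hA]

lemma continuousAt_inv {A : Matrix (Fin d) (Fin d) ℝ} (hA : IsUnit A) :
    ContinuousAt (fun B : Matrix (Fin d) (Fin d) ℝ => B⁻¹) A := by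
  have hdet : A.det ≠ 0 := ((Matrix.isUnit_iff_isUnit_det A).1 hA).ne_zero
  simp only [Matrix.inv_def, Ring.inverse_eq_inv']
  exact ContinuousAt.smul (ContinuousAt.inv₀ (Continuous.continuousAt (by fun_prop)) hdet)
    (Continuous.continuousAt (by fun_prop))

lemma measurable_inv : Measurable fun B : Matrix (Fin d) (Fin d) ℝ => B⁻¹ := by
  have h1 : Measurable fun B : Matrix (Fin d) (Fin d) ℝ => B.det :=
    Continuous.measurable (by fun_prop)
  have h2 : Measurable fun B : Matrix (Fin d) (Fin d) ℝ => B.adjugate :=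
    Continuous.measurable (by fun_prop)
  simp only [Matrix.inv_def, Ring.inverse_eq_inv']
  refine measurable_pi_lambda _ fun i => measurable_pi_lambda _ fun j => ?_
  exact h1.inv.mul ((measurable_pi_apply j).comp ((measurable_pi_apply i).comp h2))

lemma measurable_matrix_mul {α : Type*} [MeasurableSpace α] {a b c : ℕ}
    {f : α → Matrix (Fin a) (Fin b) ℝ} {g : α → Matrix (Fin b) (Fin c) ℝ}
    (hf : Measurable f) (hg : Measurable g) : Measurable fun x => f x * g x :=
  (Continuous.measurable (by fun_prop : Continuous fun y :
    Matrix (Fin a) (Fin b) ℝ × Matrix (Fin b) (Fin c) ℝ => y.1 * y.2)).comp (hf.prodMk hg)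

lemma isOpen_isUnit : IsOpen {A : Matrix (Fin d) (Fin d) ℝ | IsUnit A} := by
  simp only [Matrix.isUnit_iff_isUnit_det, isUnit_iff_ne_zero]
  exact isOpen_ne_fun (by fun_prop) continuous_const

lemma measurableSet_posDef : MeasurableSet {A : Matrix (Fin d) (Fin d) ℝ | A.PosDef} := by
  have : {A : Matrix (Fin d) (Fin d) ℝ | A.PosDef} = {A | A.PosSemidef} ∩ {A | IsUnit A} :=
    Set.ext fun A => ⟨fun h => ⟨h.posSemidef, h.isUnit⟩, fun h => h.1.posDef_iff_isUnit.2 h.2⟩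
  rw [this]
  exact isClosed_posSemidef.measurableSet.inter isOpen_isUnit.measurableSet

lemma measurable_invSqrt : Measurable (invSqrt (d := d)) :=
  measurable_inv.comp measurable_sqrt

lemma isUnit_sqrt {A : Matrix (Fin d) (Fin d) ℝ} (hA : A.PosDef) : IsUnit (CFC.sqrt A) := by
  refine isUnit_of_mul_isUnit_left (y := CFC.sqrt A) ?_
  rw [sqrt_mul_sqrt hA.posSemidef]
  exact hA.isUnit

/-- Only continuity within the positive semidefinite matrices is available: for `d ≥ 2` every
neighbourhood of `A` contains nonsymmetric matrices, where the root is 0 by default. -/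
lemma continuousWithinAt_invSqrt {A : Matrix (Fin d) (Fin d) ℝ} (hA : A.PosDef) :
    ContinuousWithinAt (invSqrt (d := d)) {A | A.PosSemidef} A :=
  (continuousAt_inv (isUnit_sqrt hA)).comp_continuousWithinAt
    (continuousOn_sqrt A hA.posSemidef)

lemma transpose_sqrt (A : Matrix (Fin d) (Fin d) ℝ) : (CFC.sqrt A).transpose = CFC.sqrt A := by
  simpa using (posSemidef_sqrt A).isHermitian.eq

lemma transpose_invSqrt (A : Matrix (Fin d) (Fin d) ℝ) :
    (invSqrt A).transpose = invSqrt A := by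
  rw [invSqrt, Matrix.transpose_nonsing_inv, transpose_sqrt]

lemma invSqrt_mul_mul_invSqrt {A : Matrix (Fin d) (Fin d) ℝ} (hA : A.PosDef) :
    invSqrt A * A * invSqrt A = 1 := by
  have hu := (Matrix.isUnit_iff_isUnit_det _).1 (isUnit_sqrt hA)
  nth_rw 2 [← sqrt_mul_sqrt hA.posSemidef]
  rw [invSqrt, ← Matrix.mul_assoc, Matrix.nonsing_inv_mul _ hu, Matrix.one_mul,
    Matrix.mul_nonsing_inv _ hu]

end MatrixAnalysis

/-! ### The generalized least-squares estimator in closed form and the covariance estimator. -/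

section Algebra

open Matrix
open scoped MatrixOrder

lemma mulVec_injective_of_rank_eq {n d : ℕ} {A : Matrix (Fin n) (Fin d) ℝ} (h : A.rank = d) :
    Function.Injective A.mulVec := by
  have h1 := LinearMap.finrank_range_add_finrank_ker A.mulVecLin
  rw [← Matrix.rank, h, Module.finrank_fin_fun] at h1
  have h2 : LinearMap.ker A.mulVecLin = ⊥ := Submodule.finrank_eq_zero.1 (by omega)
  exact LinearMap.ker_eq_bot.1 h2

lemma posDef_transpose_mul_mul {n d : ℕ} {A : Matrix (Fin n) (Fin d) ℝ} (h : A.rank = d)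
    {S : Matrix (Fin n) (Fin n) ℝ} (hS : S.PosDef) : (Aᵀ * S * A).PosDef := by
  simpa using hS.conjTranspose_mul_mul_same (mulVec_injective_of_rank_eq h)

lemma posDef_transpose_mul_self {n d : ℕ} {A : Matrix (Fin n) (Fin d) ℝ} (h : A.rank = d) :
    (Aᵀ * A).PosDef := by
  simpa using posDef_transpose_mul_mul h Matrix.PosDef.one

lemma PosDef.inv_mul_self {d : ℕ} {A : Matrix (Fin d) (Fin d) ℝ} (hA : A.PosDef) : A⁻¹ * A = 1 :=
  Matrix.nonsing_inv_mul _ ((Matrix.isUnit_iff_isUnit_det _).1 hA.isUnit)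

lemma PosDef.mul_inv_self {d : ℕ} {A : Matrix (Fin d) (Fin d) ℝ} (hA : A.PosDef) : A * A⁻¹ = 1 :=
  Matrix.mul_nonsing_inv _ ((Matrix.isUnit_iff_isUnit_det _).1 hA.isUnit)

lemma PosDef.transpose_eq {d : ℕ} {A : Matrix (Fin d) (Fin d) ℝ} (hA : A.PosDef) : Aᵀ = A := by
  simpa using hA.isHermitian.eq

variable {k n p : ℕ} {m q : Fin k → ℕ}
  {X : ∀ j, Matrix (Fin n) (Fin (m j)) ℝ} {Z : ∀ j, Matrix (Fin p) (Fin (q j)) ℝ}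

lemma meanStructure_sub (T T' : ∀ j, Matrix (Fin (m j)) (Fin (q j)) ℝ) :
    meanStructure X Z T - meanStructure X Z T' = meanStructure X Z (T - T') := by
  simp [meanStructure, Matrix.mul_sub, Matrix.sub_mul]

lemma transpose_mul_meanStructure (hX : IsOrthogonalDesign p X)
    (T : ∀ j, Matrix (Fin (m j)) (Fin (q j)) ℝ) (j : Fin k) :
    (X j)ᵀ * meanStructure X Z T = (X j)ᵀ * X j * T j * (Z j)ᵀ := by
  rw [meanStructure, Matrix.mul_sum, Finset.sum_eq_single j]
  · simp only [Matrix.mul_assoc]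
  · intro b _ hb
    rw [← Matrix.mul_assoc, ← Matrix.mul_assoc, hX.orthogonal j b hb.symm]
    simp
  · simp

/-- The generalized least-squares estimate for a known matrix `S` in place of the covariance. -/
noncomputable def glsEstimate (X : ∀ j, Matrix (Fin n) (Fin (m j)) ℝ)
    (Z : ∀ j, Matrix (Fin p) (Fin (q j)) ℝ) (S : Matrix (Fin p) (Fin p) ℝ)
    (Y : Matrix (Fin n) (Fin p) ℝ) (j : Fin k) : Matrix (Fin (m j)) (Fin (q j)) ℝ :=
  ((X j)ᵀ * X j)⁻¹ * (X j)ᵀ * Y * S⁻¹ * Z j * ((Z j)ᵀ * S⁻¹ * Z j)⁻¹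

/-- Multiplication by `(X j)ᵀ` leaves only the `j`-th summand of the mean, so each block can be
solved separately; the two Gram matrices then cancel. -/
lemma normal_equations (hX : IsOrthogonalDesign p X) (hZ : ∀ j, (Z j).rank = q j)
    {S : Matrix (Fin p) (Fin p) ℝ} (hS : S.PosDef) (Y : Matrix (Fin n) (Fin p) ℝ) (j : Fin k) :
    (X j)ᵀ * (Y - meanStructure X Z (glsEstimate X Z S Y)) * S⁻¹ * Z j = 0 := by
  have hG := PosDef.mul_inv_self (posDef_transpose_mul_self (hX.rank_eq j))
  have hH := PosDef.inv_mul_self (posDef_transpose_mul_mul (hZ j) hS.inv)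
  have h1 : (X j)ᵀ * X j * glsEstimate X Z S Y j * (Z j)ᵀ * S⁻¹ * Z j =
      ((X j)ᵀ * X j * ((X j)ᵀ * X j)⁻¹) * ((X j)ᵀ * Y * S⁻¹ * Z j) *
        (((Z j)ᵀ * S⁻¹ * Z j)⁻¹ * ((Z j)ᵀ * S⁻¹ * Z j)) := by
    simp only [glsEstimate, Matrix.mul_assoc]
  rw [Matrix.mul_sub, transpose_mul_meanStructure hX, Matrix.sub_mul, Matrix.sub_mul, h1, hG, hH,
    Matrix.one_mul, Matrix.mul_one, sub_self]

lemma glsNormSq_nonneg {S : Matrix (Fin p) (Fin p) ℝ} (hS : S.PosDef)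
    (w : Matrix (Fin n) (Fin p) ℝ) : 0 ≤ glsNormSq S w := by
  simpa [glsNormSq] using (hS.inv.posSemidef.mul_mul_conjTranspose_same w).trace_nonneg

lemma eq_zero_of_glsNormSq_eq_zero {S : Matrix (Fin p) (Fin p) ℝ} (hS : S.PosDef)
    {w : Matrix (Fin n) (Fin p) ℝ} (h : glsNormSq S w = 0) : w = 0 := by
  have hsq := sqrt_mul_sqrt hS.inv.posSemidef
  set B := CFC.sqrt S⁻¹ with hB
  have hu : IsUnit B := isUnit_sqrt hS.inv
  have h2 : (w * B * (w * B)ᴴ).trace = 0 := by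
    rw [Matrix.conjTranspose_eq_transpose_of_trivial, Matrix.transpose_mul, hB, transpose_sqrt,
      ← hB, Matrix.mul_assoc, ← Matrix.mul_assoc B, hsq, ← Matrix.mul_assoc]
    exact h
  have h3 := Matrix.trace_mul_conjTranspose_self_eq_zero_iff.1 h2
  calc w = w * B * B⁻¹ := by
        rw [Matrix.mul_assoc, Matrix.mul_nonsing_inv _ ((Matrix.isUnit_iff_isUnit_det _).1 hu),
          Matrix.mul_one]
    _ = 0 := by rw [h3, Matrix.zero_mul]

lemma glsNormSq_add {S : Matrix (Fin p) (Fin p) ℝ} (hS : S.PosDef)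
    {w v : Matrix (Fin n) (Fin p) ℝ} (h : (w * S⁻¹ * vᵀ).trace = 0) :
    glsNormSq S (w + v) = glsNormSq S w + glsNormSq S v := by
  have h' : (v * S⁻¹ * wᵀ).trace = 0 := by
    rw [← Matrix.trace_transpose, Matrix.transpose_mul, Matrix.transpose_mul,
      Matrix.transpose_transpose, PosDef.transpose_eq hS.inv, ← Matrix.mul_assoc, h]
  simp only [glsNormSq, Matrix.add_mul, Matrix.transpose_add, Matrix.mul_add, Matrix.trace_add, h,
    h']
  ring

/-- Pythagoras: by the normal equations the residual is orthogonal to every mean structure for the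
form `tr (w S⁻¹ v')`. -/
lemma glsNormSq_sub_meanStructure (hX : IsOrthogonalDesign p X) (hZ : ∀ j, (Z j).rank = q j)
    {S : Matrix (Fin p) (Fin p) ℝ} (hS : S.PosDef) (Y : Matrix (Fin n) (Fin p) ℝ)
    (T : ∀ j, Matrix (Fin (m j)) (Fin (q j)) ℝ) :
    glsNormSq S (Y - meanStructure X Z T) =
      glsNormSq S (Y - meanStructure X Z (glsEstimate X Z S Y)) +
        glsNormSq S (meanStructure X Z (glsEstimate X Z S Y - T)) := by
  rw [← glsNormSq_add hS, ← meanStructure_sub]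
  · congr 1; abel
  · simp only [meanStructure, Matrix.transpose_sum, Matrix.mul_sum, Matrix.trace_sum]
    refine Finset.sum_eq_zero fun j _ => ?_
    have h := normal_equations hX hZ hS Y j
    simp only [Matrix.transpose_mul, Matrix.transpose_transpose, ← Matrix.mul_assoc]
    rw [Matrix.trace_mul_comm, ← Matrix.mul_assoc, ← Matrix.mul_assoc, ← Matrix.mul_assoc]
    rw [← meanStructure.eq_def, h]
    simp

lemma meanStructure_injective (hX : IsOrthogonalDesign p X) (hZ : ∀ j, (Z j).rank = q j)
    {D : ∀ j, Matrix (Fin (m j)) (Fin (q j)) ℝ} (h : meanStructure X Z D = 0) : D = 0 := by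
  funext j
  have hG := PosDef.inv_mul_self (posDef_transpose_mul_self (hX.rank_eq j))
  have hH := PosDef.mul_inv_self (posDef_transpose_mul_self (hZ j))
  have h1 := transpose_mul_meanStructure (Z := Z) hX D j
  rw [h, Matrix.mul_zero] at h1
  calc D j = (((X j)ᵀ * X j)⁻¹ * ((X j)ᵀ * X j)) * D j *
        (((Z j)ᵀ * Z j) * ((Z j)ᵀ * Z j)⁻¹) := by rw [hG, hH, Matrix.one_mul, Matrix.mul_one]
    _ = ((X j)ᵀ * X j)⁻¹ * ((X j)ᵀ * X j * D j * (Z j)ᵀ) * (Z j * ((Z j)ᵀ * Z j)⁻¹) := by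
        simp only [Matrix.mul_assoc]
    _ = 0 := by rw [← h1]; simp

/-- The excess of the criterion at `T` is the squared norm of a mean structure. It is nonnegative
and vanishes only at the closed form, so the choice in the definition is forced. -/
lemma twoStageGLS_of_posDef (hX : IsOrthogonalDesign p X) (hZ : ∀ j, (Z j).rank = q j)
    {Y : Matrix (Fin n) (Fin p) ℝ} (hS : (covEstimator X Y).PosDef) :
    twoStageGLS X Z Y = glsEstimate X Z (covEstimator X Y) Y := by
  have hex : ∃ T, IsTwoStageGLS X Z Y T := by
    refine ⟨glsEstimate X Z (covEstimator X Y) Y, hS, fun T' => ?_⟩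
    rw [glsNormSq_sub_meanStructure hX hZ hS Y T']
    linarith [glsNormSq_nonneg hS
      (meanStructure X Z (glsEstimate X Z (covEstimator X Y) Y - T'))]
  rw [twoStageGLS, dif_pos hex]
  obtain ⟨_, hmin⟩ := hex.choose_spec
  set T := hex.choose
  have h1 := hmin (glsEstimate X Z (covEstimator X Y) Y)
  rw [glsNormSq_sub_meanStructure hX hZ hS Y T] at h1
  have h2 := glsNormSq_nonneg hS (meanStructure X Z (glsEstimate X Z (covEstimator X Y) Y - T))
  have h3 := meanStructure_injective hX hZ
    (eq_zero_of_glsNormSq_eq_zero hS (le_antisymm (by linarith) h2))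
  exact (sub_eq_zero.1 h3).symm

lemma twoStageGLS_of_not_posDef {Y : Matrix (Fin n) (Fin p) ℝ}
    (hS : ¬ (covEstimator X Y).PosDef) : twoStageGLS X Z Y = 0 := by
  rw [twoStageGLS, dif_neg]
  exact fun ⟨_, h, _⟩ => hS h

/-- The projection onto the orthogonal complement of the column spaces of the design matrices. -/
noncomputable def residualProj (X : ∀ j, Matrix (Fin n) (Fin (m j)) ℝ) :
    Matrix (Fin n) (Fin n) ℝ :=
  1 - ∑ j, colProj (X j)

lemma transpose_colProj {d : ℕ} (A : Matrix (Fin n) (Fin d) ℝ) : (colProj A)ᵀ = colProj A := by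
  simp [colProj, Matrix.transpose_mul, Matrix.transpose_nonsing_inv, Matrix.mul_assoc]

lemma transpose_residualProj : (residualProj X)ᵀ = residualProj X := by
  simp [residualProj, Matrix.transpose_sum, transpose_colProj]

lemma residualProj_mul (hX : IsOrthogonalDesign p X) (j : Fin k) : residualProj X * X j = 0 := by
  rw [residualProj, Matrix.sub_mul, Matrix.one_mul, Matrix.sum_mul, Finset.sum_eq_single j]
  · rw [colProj, Matrix.mul_assoc, Matrix.mul_assoc,
      PosDef.inv_mul_self (posDef_transpose_mul_self (hX.rank_eq j)), Matrix.mul_one, sub_self]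
  · intro b _ hb
    rw [colProj, Matrix.mul_assoc, hX.orthogonal b j hb, Matrix.mul_zero]
  · simp

lemma residualProj_mul_self (hX : IsOrthogonalDesign p X) :
    residualProj X * residualProj X = residualProj X := by
  nth_rw 2 [residualProj]
  rw [Matrix.mul_sub, Matrix.mul_one, Matrix.mul_sum, Finset.sum_eq_zero, sub_zero]
  intro j _
  rw [colProj, ← Matrix.mul_assoc, ← Matrix.mul_assoc, residualProj_mul hX]
  simp

lemma residualProj_mul_meanStructure (hX : IsOrthogonalDesign p X)
    (T : ∀ j, Matrix (Fin (m j)) (Fin (q j)) ℝ) :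
    residualProj X * meanStructure X Z T = 0 := by
  rw [meanStructure, Matrix.mul_sum]
  refine Finset.sum_eq_zero fun j _ => ?_
  rw [← Matrix.mul_assoc, ← Matrix.mul_assoc, residualProj_mul hX]
  simp

lemma covEstimator_eq (Y : Matrix (Fin n) (Fin p) ℝ) :
    covEstimator X Y =
      ((n : ℝ) - ∑ j, ((X j).rank : ℝ))⁻¹ • (Yᵀ * residualProj X * Y) := by
  simp [covEstimator, residualProj]

lemma covEstimator_meanStructure_add (hX : IsOrthogonalDesign p X)
    (T : ∀ j, Matrix (Fin (m j)) (Fin (q j)) ℝ) (E : Matrix (Fin n) (Fin p) ℝ) :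
    covEstimator X (meanStructure X Z T + E) = covEstimator X E := by
  have h := residualProj_mul_meanStructure (Z := Z) hX T
  have h' : (meanStructure X Z T)ᵀ * residualProj X = 0 := by
    rw [← transpose_residualProj, ← Matrix.transpose_mul, h, Matrix.transpose_zero]
  rw [covEstimator_eq, covEstimator_eq, Matrix.transpose_add, Matrix.add_mul, h', zero_add,
    Matrix.mul_add, Matrix.mul_assoc, h, Matrix.mul_zero, zero_add]

lemma covEstimator_eq_sub (E : Matrix (Fin n) (Fin p) ℝ) :
    covEstimator X E = ((n : ℝ) - ∑ j, ((X j).rank : ℝ))⁻¹ •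
      (Eᵀ * E - ∑ j, ((X j)ᵀ * E)ᵀ * ((X j)ᵀ * X j)⁻¹ * ((X j)ᵀ * E)) := by
  rw [covEstimator_eq, residualProj, Matrix.mul_sub, Matrix.sub_mul, Matrix.mul_one,
    Matrix.mul_sum, Matrix.sum_mul]
  simp only [colProj, Matrix.transpose_mul, Matrix.transpose_transpose, Matrix.mul_assoc]

lemma posSemidef_covEstimator (hX : IsOrthogonalDesign p X) (hn : ∑ j, m j ≤ n)
    (Y : Matrix (Fin n) (Fin p) ℝ) : (covEstimator X Y).PosSemidef := by
  have h1 : Yᵀ * residualProj X * Y = (residualProj X * Y)ᴴ * (residualProj X * Y) := by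
    rw [Matrix.conjTranspose_eq_transpose_of_trivial, Matrix.transpose_mul,
      transpose_residualProj, Matrix.mul_assoc, Matrix.mul_assoc, ← Matrix.mul_assoc (residualProj X),
      residualProj_mul_self hX]
  rw [covEstimator_eq, h1]
  refine (Matrix.posSemidef_conjTranspose_mul_self _).smul (inv_nonneg.2 ?_)
  simp only [hX.rank_eq]
  rw [sub_nonneg]
  exact_mod_cast hn

/-- The conclusion does not involve `M`: nonsingularity for a single `M` yields a condition that
serves for every positive definite one. -/
lemma transpose_mulVec_injective_of_isUnit {s d : ℕ} {C : Matrix (Fin s) (Fin d) ℝ}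
    {M : Matrix (Fin d) (Fin d) ℝ} (h : IsUnit (C * M * Cᵀ)) :
    Function.Injective (Cᵀ).mulVec := by
  intro v w hvw
  have h1 : (C * M * Cᵀ).mulVec v = (C * M * Cᵀ).mulVec w := by
    rw [← Matrix.mulVec_mulVec, hvw, Matrix.mulVec_mulVec]
  exact Matrix.mulVec_injective_iff_isUnit.2 h h1

lemma posDef_mul_mul_transpose {s d : ℕ} {C : Matrix (Fin s) (Fin d) ℝ}
    (hC : Function.Injective (Cᵀ).mulVec) {M : Matrix (Fin d) (Fin d) ℝ} (hM : M.PosDef) :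
    (C * M * Cᵀ).PosDef := by
  simpa using hM.conjTranspose_mul_mul_same (B := Cᵀ) hC

end Algebra

/-! ### Convergence in probability, stated with neighbourhoods so that no norm on matrices has to be
fixed. -/

section ConvergenceInProbability

variable {Ω : Type*} [MeasurableSpace Ω] {P : Measure Ω}

/-- Convergence in probability to a constant, for random elements of a topological space. -/
def TendstoInProb {E : Type*} [TopologicalSpace E] (P : Measure Ω) (f : ℕ → Ω → E) (c : E) :
    Prop :=
  ∀ U ∈ 𝓝 c, Tendsto (fun n => P {ω | f n ω ∉ U}) atTop (𝓝 0)

lemma tendsto_measure_zero_of_subset_union {A B C : ℕ → Set Ω} (h : ∀ n, A n ⊆ B n ∪ C n)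
    (hB : Tendsto (fun n => P (B n)) atTop (𝓝 0)) (hC : Tendsto (fun n => P (C n)) atTop (𝓝 0)) :
    Tendsto (fun n => P (A n)) atTop (𝓝 0) :=
  tendsto_of_tendsto_of_tendsto_of_le_of_le tendsto_const_nhds (by simpa using hB.add hC)
    (fun _ => zero_le) fun n => (measure_mono (h n)).trans (measure_union_le _ _)

namespace TendstoInProb

variable {E F : Type*} [TopologicalSpace E] [TopologicalSpace F] {f : ℕ → Ω → E} {c : E}

/-- Continuous mapping for a `g` continuous only relative to `s`; the event of leaving `s` is
negligible. Inverse square roots require this form. -/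
lemma comp_continuousWithinAt (hf : TendstoInProb P f c) {g : E → F} {s : Set E}
    (hg : ContinuousWithinAt g s c) (hs : Tendsto (fun n => P {ω | f n ω ∉ s}) atTop (𝓝 0)) :
    TendstoInProb P (fun n ω => g (f n ω)) (g c) := by
  intro U hU
  obtain ⟨V, hV, hVU⟩ := mem_nhdsWithin_iff_exists_mem_nhds_inter.1 (hg hU)
  refine tendsto_measure_zero_of_subset_union (fun n ω hω => ?_) (hf V hV) hs
  by_contra hcon
  simp only [Set.mem_union, Set.mem_ofPred_eq, not_or, not_not] at hcon
  exact hω (hVU hcon)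

lemma comp_continuousAt (hf : TendstoInProb P f c) {g : E → F} (hg : ContinuousAt g c) :
    TendstoInProb P (fun n ω => g (f n ω)) (g c) :=
  hf.comp_continuousWithinAt (s := Set.univ) hg.continuousWithinAt (by simp)

lemma of_tendsto {u : ℕ → E} (hu : Tendsto u atTop (𝓝 c)) :
    TendstoInProb P (fun n (_ : Ω) => u n) c := by
  intro U hU
  refine tendsto_const_nhds.congr' ?_
  filter_upwards [hu hU] with n hn
  have hn' : u n ∈ U := hn
  simp [hn']

lemma congr' (hf : TendstoInProb P f c) {g : ℕ → Ω → E}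
    (h : Tendsto (fun n => P {ω | f n ω ≠ g n ω}) atTop (𝓝 0)) : TendstoInProb P g c := by
  intro U hU
  refine tendsto_measure_zero_of_subset_union (fun n ω hω => ?_) (hf U hU) h
  by_contra hcon
  simp only [Set.mem_union, Set.mem_ofPred_eq, not_or, not_not, ne_eq] at hcon
  exact hω (hcon.2 ▸ hcon.1)

lemma prodMk (hf : TendstoInProb P f c) {g : ℕ → Ω → F} {e : F} (hg : TendstoInProb P g e) :
    TendstoInProb P (fun n ω => (f n ω, g n ω)) (c, e) := by
  intro U hU
  obtain ⟨V, hV, W, hW, hVW⟩ := mem_nhds_prod_iff.1 hU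
  refine tendsto_measure_zero_of_subset_union (fun n ω hω => ?_) (hf V hV) (hg W hW)
  by_contra hcon
  simp only [Set.mem_union, Set.mem_ofPred_eq, not_or, not_not] at hcon
  exact hω (hVW ⟨hcon.1, hcon.2⟩)

lemma pi {ι : Type*} [Fintype ι] {G : ι → Type*} [∀ i, TopologicalSpace (G i)]
    {f : ℕ → Ω → ∀ i, G i} {c : ∀ i, G i} (hf : ∀ i, TendstoInProb P (fun n ω => f n ω i) (c i)) :
    TendstoInProb P f c := by
  intro U hU
  rw [nhds_pi, Filter.mem_pi'] at hU
  obtain ⟨I, V, hV, hVU⟩ := hU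
  have hsum : Tendsto (fun n => ∑ i, P {ω | f n ω i ∉ V i}) atTop (𝓝 0) := by
    simpa using tendsto_finsetSum Finset.univ fun i _ => hf i (V i) (hV i)
  refine tendsto_of_tendsto_of_tendsto_of_le_of_le tendsto_const_nhds hsum
    (fun _ => zero_le) fun n => ?_
  refine (measure_mono (t := ⋃ i, {ω | f n ω i ∉ V i}) fun ω hω => ?_).trans
    (measure_iUnion_fintype_le _ _)
  by_contra hcon
  simp only [Set.mem_iUnion, Set.mem_ofPred_eq, not_exists, not_not] at hcon
  exact hω (hVU fun i _ => hcon i)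

lemma matrix {a b : ℕ} {f : ℕ → Ω → Matrix (Fin a) (Fin b) ℝ} {c : Matrix (Fin a) (Fin b) ℝ}
    (hf : ∀ i j, TendstoInProb P (fun n ω => f n ω i j) (c i j)) : TendstoInProb P f c :=
  TendstoInProb.pi (G := fun _ : Fin a => Fin b → ℝ) fun i => TendstoInProb.pi fun j => hf i j

lemma of_tendstoInMeasure {E : Type*} [PseudoMetricSpace E] {f : ℕ → Ω → E} {c : E}
    (h : TendstoInMeasure P f atTop fun _ => c) : TendstoInProb P f c := by
  intro U hU
  obtain ⟨r, hr, hrU⟩ := Metric.mem_nhds_iff.1 hU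
  rw [tendstoInMeasure_iff_dist] at h
  refine tendsto_of_tendsto_of_tendsto_of_le_of_le tendsto_const_nhds (h r hr)
    (fun _ => zero_le) fun n => measure_mono fun ω hω => ?_
  by_contra hcon
  exact hω (hrU (by simpa using hcon))

lemma tendstoInMeasure {E : Type*} [PseudoMetricSpace E] {f : ℕ → Ω → E} {c : E}
    (h : TendstoInProb P f c) : TendstoInMeasure P f atTop fun _ => c := by
  rw [tendstoInMeasure_iff_dist]
  intro r hr
  refine (h (Metric.ball c r) (Metric.ball_mem_nhds c hr)).congr fun n => ?_
  simp

end TendstoInProb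

variable [IsProbabilityMeasure P]

/-- Weighted sums of centred i.i.d. square integrable variables converge to zero in probability
when the sum of the squared weights tends to zero. -/
lemma tendstoInProb_weighted_sum {ξ : ℕ → Ω → ℝ} (hindep : iIndepFun ξ P)
    (hident : ∀ l, IdentDistrib (ξ l) (ξ 0) P P) (hL2 : MemLp (ξ 0) 2 P)
    (hmean : ∫ ω, ξ 0 ω ∂P = 0) (w : ∀ n : ℕ, Fin n → ℝ)
    (hw : Tendsto (fun n => ∑ l, w n l ^ 2) atTop (𝓝 0)) :
    TendstoInProb P (fun n ω => ∑ l, w n l * ξ l ω) 0 := by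
  have hmem : ∀ l, MemLp (ξ l) 2 P := fun l => (hident l).memLp_iff.2 hL2
  have hmem' : ∀ n (l : Fin n), MemLp (fun ω => w n l * ξ l ω) 2 P :=
    fun n l => (hmem l).const_mul _
  have hsum : ∀ n, MemLp (fun ω => ∑ l, w n l * ξ l ω) 2 P :=
    fun n => memLp_finsetSum _ fun l _ => hmem' n l
  have hexp : ∀ n, ∫ ω, ∑ l, w n l * ξ l ω ∂P = 0 := by
    intro n
    rw [integral_finsetSum _ fun l _ => (hmem' n l).integrable (by norm_num)]
    refine Finset.sum_eq_zero fun l _ => ?_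
    rw [integral_const_mul, (hident l).integral_eq, hmean, mul_zero]
  have hvar : ∀ n, Var[fun ω => ∑ l, w n l * ξ l ω; P] = (∑ l, w n l ^ 2) * Var[ξ 0; P] := by
    intro n
    have h := IndepFun.variance_sum (μ := P) (X := fun l : Fin n => fun ω => w n l * ξ l ω)
      (s := Finset.univ) (fun l _ => hmem' n l) (fun l _ l' _ hll => by
        have := hindep.indepFun (i := (l : ℕ)) (j := l') (fun h => hll (Fin.ext h))
        exact this.comp (φ := fun x => w n l * x) (ψ := fun x => w n l' * x)
          (by fun_prop) (by fun_prop))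
    have h' : (∑ l : Fin n, fun ω => w n l * ξ l ω) = fun ω => ∑ l, w n l * ξ l ω := by
      ext ω; simp
    rw [← h', h, Finset.sum_mul]
    refine Finset.sum_congr rfl fun l _ => ?_
    rw [variance_const_mul, (hident l).variance_eq]
  -- Chebyshev's inequality with the variance computed above.
  refine TendstoInProb.of_tendstoInMeasure (tendstoInMeasure_iff_norm.2 fun r hr => ?_)
  have hlim : Tendsto (fun n => ENNReal.ofReal ((∑ l, w n l ^ 2) * Var[ξ 0; P] / r ^ 2)) atTop
      (𝓝 0) := by
    have := ENNReal.tendsto_ofReal ((hw.mul_const (Var[ξ 0; P])).div_const (r ^ 2))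
    simpa using this
  refine tendsto_of_tendsto_of_tendsto_of_le_of_le tendsto_const_nhds hlim
    (fun _ => zero_le) fun n => ?_
  have h := meas_ge_le_variance_div_sq (hsum n) hr
  simp only [hexp, hvar, sub_zero] at h
  simpa [Real.norm_eq_abs] using h

lemma tendstoInProb_average {ξ : ℕ → Ω → ℝ} (hindep : iIndepFun ξ P)
    (hident : ∀ l, IdentDistrib (ξ l) (ξ 0) P P) (hint : Integrable (ξ 0) P) :
    TendstoInProb P (fun n ω => (n : ℝ)⁻¹ * ∑ l : Fin n, ξ l ω) (∫ ω, ξ 0 ω ∂P) := by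
  have h := strong_law_ae ξ hint (fun i j hij => hindep.indepFun hij) hident
  refine TendstoInProb.of_tendstoInMeasure (tendstoInMeasure_of_tendsto_ae (fun n => ?_) ?_)
  · have : ∀ l, AEStronglyMeasurable (ξ l) P :=
      fun l => (hident l).aemeasurable_fst.aestronglyMeasurable
    fun_prop
  · filter_upwards [h] with ω hω
    refine hω.congr fun n => ?_
    rw [Finset.sum_range, smul_eq_mul]

end ConvergenceInProbability

/-! ### Second order expansion of characteristic functions and convergence of their products. -/

section CharFun

/-- The global quadratic bound provides the dominating function and the local cubic bound the
pointwise limit in `charFun_sub_isLittleO`. -/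
lemma norm_exp_sub_quadratic_le (x : ℝ) :
    ‖Complex.exp (x * Complex.I) - (1 + x * Complex.I - x ^ 2 / 2)‖ ≤ 4 * x ^ 2 ∧
      (|x| ≤ 1 →
        ‖Complex.exp (x * Complex.I) - (1 + x * Complex.I - x ^ 2 / 2)‖ ≤ |x| ^ 3) := by
  have hsmall : |x| ≤ 1 →
      ‖Complex.exp (x * Complex.I) - (1 + x * Complex.I - x ^ 2 / 2)‖ ≤ |x| ^ 3 := by
    intro hx
    have hn : ‖(x * Complex.I : ℂ)‖ = |x| := by simp
    have h := Complex.exp_bound (x := x * Complex.I) (by rwa [hn]) (n := 3) (by norm_num)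
    have hs : ∑ k ∈ Finset.range 3, (x * Complex.I : ℂ) ^ k / (k.factorial : ℂ) =
        1 + x * Complex.I - x ^ 2 / 2 := by
      simp only [Finset.sum_range_succ, Finset.sum_range_zero, mul_pow, Complex.I_sq]
      norm_num [Nat.factorial]
      ring
    rw [hs, hn] at h
    refine h.trans ?_
    have : (0 : ℝ) ≤ |x| ^ 3 := by positivity
    norm_num [Nat.factorial]
    nlinarith
  refine ⟨?_, hsmall⟩
  by_cases hx : |x| ≤ 1
  · refine (hsmall hx).trans ?_
    rw [← sq_abs x]
    nlinarith [abs_nonneg x, sq_nonneg |x|]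
  · push Not at hx
    have h1 : ‖Complex.exp (x * Complex.I)‖ = 1 := Complex.norm_exp_ofReal_mul_I x
    have h2 : ‖(1 + x * Complex.I - x ^ 2 / 2 : ℂ)‖ ≤ 1 + |x| + x ^ 2 / 2 := by
      refine (norm_sub_le _ _).trans (add_le_add ((norm_add_le _ _).trans ?_) ?_)
      · simp
      · simp
    refine (norm_sub_le _ _).trans ?_
    rw [h1]
    nlinarith [sq_abs x]

variable {E : Type*} [NormedAddCommGroup E] [InnerProductSpace ℝ E] [MeasurableSpace E]
  [BorelSpace E] [SecondCountableTopology E]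

/-- Second order expansion at the origin of the characteristic function of a centred law with
identity covariance. -/
lemma charFun_sub_isLittleO (μ : Measure E) [IsProbabilityMeasure μ] (hL2 : MemLp id 2 μ)
    (hmean : ∀ v : E, ∫ x, inner ℝ x v ∂μ = 0) (hcov : ∀ v : E, ∫ x, inner ℝ x v ^ 2 ∂μ = ‖v‖ ^ 2) :
    (fun v => charFun μ v - (1 - (‖v‖ ^ 2 : ℝ) / 2)) =o[𝓝 0] fun v : E => ‖v‖ ^ 2 := by
  have hsq : Integrable (fun x : E => ‖x‖ ^ 2) μ := by
    simpa using hL2.integrable_norm_pow (by norm_num)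
  have hinner : ∀ v : E, Integrable (fun x => inner ℝ x v) μ := fun v => by
    refine ((hL2.integrable (by norm_num)).norm.mul_const ‖v‖).mono' (by fun_prop) ?_
    exact Eventually.of_forall fun x => norm_inner_le_norm x v
  have hbd : ∀ x v : E, (inner ℝ x v) ^ 2 ≤ ‖x‖ ^ 2 * ‖v‖ ^ 2 := fun x v => by
    rw [← mul_pow, ← sq_abs]
    exact pow_le_pow_left₀ (abs_nonneg _) (abs_real_inner_le_norm x v) 2
  have hinner2 : ∀ v : E, Integrable (fun x => inner ℝ x v ^ 2) μ := fun v => by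
    refine (hsq.mul_const (‖v‖ ^ 2)).mono' (by fun_prop) (Eventually.of_forall fun x => ?_)
    rw [Real.norm_of_nonneg (sq_nonneg _)]
    exact hbd x v
  let h : ℝ → ℂ := fun y => Complex.exp (y * Complex.I) - (1 + y * Complex.I - y ^ 2 / 2)
  have hcont : Continuous h := by fun_prop
  have hint : ∀ v : E, charFun μ v - (1 - (‖v‖ ^ 2 : ℝ) / 2) = ∫ x, h (inner ℝ x v) ∂μ := by
    intro v
    have e1 : Integrable (fun x => Complex.exp ((inner ℝ x v : ℝ) * Complex.I)) μ := by
      refine Integrable.of_bound (C := 1) (by fun_prop) (Eventually.of_forall fun x => ?_)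
      rw [Complex.norm_exp_ofReal_mul_I]
    have e2 : Integrable (fun x => ((inner ℝ x v : ℝ) : ℂ) * Complex.I) μ :=
      (hinner v).ofReal.mul_const _
    have e3 : Integrable (fun x => ((inner ℝ x v : ℝ) : ℂ) ^ 2 / 2) μ := by
      have := ((hinner2 v).ofReal (𝕜 := ℂ)).div_const 2
      simpa using this
    have e4 : Integrable (fun x => 1 + ((inner ℝ x v : ℝ) : ℂ) * Complex.I) μ :=
      (integrable_const _).add e2
    have e5 : Integrable (fun x => 1 + ((inner ℝ x v : ℝ) : ℂ) * Complex.I -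
        ((inner ℝ x v : ℝ) : ℂ) ^ 2 / 2) μ := e4.sub e3
    simp only [h]
    rw [integral_sub e1 e5, integral_sub e4 e3, integral_add (integrable_const _) e2,
      integral_mul_const, integral_div, charFun_apply]
    have f1 : ∫ x, ((inner ℝ x v : ℝ) : ℂ) ∂μ = 0 := by
      rw [integral_complex_ofReal, hmean]; simp
    have f2 : ∫ x, ((inner ℝ x v : ℝ) : ℂ) ^ 2 ∂μ = (‖v‖ ^ 2 : ℝ) := by
      rw [← hcov, ← integral_complex_ofReal]
      simp
    rw [f1, f2]
    simp
  -- Dominated convergence for the remainder divided by `‖v‖²`; at `v = 0` the quotient is 0 because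
  -- `0⁻¹ = 0`.
  have hlim : Tendsto (fun v : E => ∫ x, (‖v‖ ^ 2)⁻¹ • h (inner ℝ x v) ∂μ) (𝓝 0)
      (𝓝 (∫ _, (0 : ℂ) ∂μ)) := by
    refine tendsto_integral_filter_of_dominated_convergence (fun x => 4 * ‖x‖ ^ 2)
      (Eventually.of_forall fun v => ?_) (Eventually.of_forall fun v => Eventually.of_forall
        fun x => ?_) (hsq.const_mul 4) (Eventually.of_forall fun x => ?_)
    · exact (Continuous.measurable (by fun_prop)).aestronglyMeasurable
    · rw [norm_smul, norm_inv, Real.norm_of_nonneg (sq_nonneg ‖v‖)]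
      rcases eq_or_ne v 0 with rfl | hv
      · simp
      · have : 0 < ‖v‖ ^ 2 := by positivity
        rw [inv_mul_le_iff₀ this]
        refine (norm_exp_sub_quadratic_le _).1.trans ?_
        nlinarith [hbd x v]
    · have hx : Tendsto (fun v : E => ‖x‖ * ‖v‖) (𝓝 0) (𝓝 0) := by
        have : Continuous fun v : E => ‖x‖ * ‖v‖ := by fun_prop
        simpa using this.tendsto 0
      have hx3 : Tendsto (fun v : E => ‖x‖ ^ 3 * ‖v‖) (𝓝 0) (𝓝 0) := by
        have : Continuous fun v : E => ‖x‖ ^ 3 * ‖v‖ := by fun_prop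
        simpa using this.tendsto 0
      refine squeeze_zero_norm' ?_ hx3
      filter_upwards [hx.eventually (gt_mem_nhds one_pos)] with v hv
      have hle := abs_real_inner_le_norm x v
      rw [norm_smul, norm_inv, Real.norm_of_nonneg (sq_nonneg ‖v‖)]
      rcases eq_or_ne v 0 with rfl | hv0
      · simp
      · have : 0 < ‖v‖ ^ 2 := by positivity
        rw [inv_mul_le_iff₀ this]
        refine ((norm_exp_sub_quadratic_le _).2 (hle.trans hv.le)).trans ?_
        refine (pow_le_pow_left₀ (abs_nonneg _) hle 3).trans (le_of_eq ?_)
        ring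
  simp only [integral_zero, integral_smul, ← hint] at hlim
  refine Asymptotics.isLittleO_norm_left.1 ((Asymptotics.isLittleO_iff_tendsto ?_).2 ?_)
  · intro v hv
    have : v = 0 := by simpa using hv
    subst this
    simp
  · refine (tendsto_norm_zero.comp hlim).congr fun v => ?_
    simp [div_eq_inv_mul]

/-- Telescoping: the factors are exchanged one at a time while all others stay in the unit disc. -/
lemma norm_prod_sub_prod_le {ι : Type*} (s : Finset ι) (a b : ι → ℂ) (ha : ∀ i ∈ s, ‖a i‖ ≤ 1)
    (hb : ∀ i ∈ s, ‖b i‖ ≤ 1) : ‖∏ i ∈ s, a i - ∏ i ∈ s, b i‖ ≤ ∑ i ∈ s, ‖a i - b i‖ := by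
  classical
  induction s using Finset.induction_on with
  | empty => simp
  | insert i s hi ih =>
    rw [Finset.prod_insert hi, Finset.prod_insert hi, Finset.sum_insert hi]
    have h1 : ‖∏ j ∈ s, b j‖ ≤ 1 := by
      rw [norm_prod]
      exact Finset.prod_le_one (fun _ _ => norm_nonneg _)
        fun j hj => hb j (Finset.mem_insert_of_mem hj)
    have h2 := ih (fun j hj => ha j (Finset.mem_insert_of_mem hj))
      fun j hj => hb j (Finset.mem_insert_of_mem hj)
    calc ‖a i * ∏ j ∈ s, a j - b i * ∏ j ∈ s, b j‖
        = ‖(a i - b i) * ∏ j ∈ s, b j + a i * (∏ j ∈ s, a j - ∏ j ∈ s, b j)‖ := by ring_nf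
      _ ≤ ‖a i - b i‖ * ‖∏ j ∈ s, b j‖ + ‖a i‖ * ‖∏ j ∈ s, a j - ∏ j ∈ s, b j‖ := by
          refine (norm_add_le _ _).trans ?_
          rw [norm_mul, norm_mul]
      _ ≤ ‖a i - b i‖ * 1 + 1 * ∑ j ∈ s, ‖a j - b j‖ := by
          gcongr
          exact ha i (Finset.mem_insert_self i s)
      _ = _ := by ring

/-- Each factor is compared with `exp (-‖v‖² / 2)`, which has the same second order expansion and
whose products are computed exactly. This avoids complex logarithms. -/
lemma tendsto_prod_of_isLittleO {E : Type*} [NormedAddCommGroup E] {φ : E → ℂ} (hφ1 : ∀ v, ‖φ v‖ ≤ 1)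
    (hφ : (fun v => φ v - (1 - (‖v‖ ^ 2 : ℝ) / 2)) =o[𝓝 0] fun v : E => ‖v‖ ^ 2)
    (v : ∀ n : ℕ, Fin n → E) (hv : ∀ U ∈ 𝓝 (0 : E), ∀ᶠ n in atTop, ∀ l, v n l ∈ U) {σ : ℝ}
    (hσ : Tendsto (fun n => ∑ l, ‖v n l‖ ^ 2) atTop (𝓝 σ)) :
    Tendsto (fun n => ∏ l, φ (v n l)) atTop (𝓝 (Complex.exp (-σ / 2))) := by
  let e : E → ℂ := fun w => Complex.exp ((-(‖w‖ ^ 2 / 2) : ℝ))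
  have he1 : ∀ w, ‖e w‖ ≤ 1 := fun w => by
    simp only [e, Complex.norm_exp_ofReal]
    exact Real.exp_le_one_iff.2 (by have := sq_nonneg ‖w‖; linarith)
  have he : (fun w => e w - (1 - (‖w‖ ^ 2 : ℝ) / 2)) =o[𝓝 0] fun w : E => ‖w‖ ^ 2 := by
    rw [Asymptotics.isLittleO_iff]
    intro c hc
    have h1 : Tendsto (fun w : E => ‖w‖ ^ 2) (𝓝 0) (𝓝 0) := by
      have : Continuous fun w : E => ‖w‖ ^ 2 := by fun_prop
      simpa using this.tendsto 0
    filter_upwards [h1.eventually (gt_mem_nhds one_pos), h1.eventually (gt_mem_nhds hc)]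
      with w hw hwc
    have hz : ‖((-(‖w‖ ^ 2 / 2) : ℝ) : ℂ)‖ = ‖w‖ ^ 2 / 2 := by
      rw [Complex.norm_real, norm_neg, Real.norm_of_nonneg (by positivity)]
    have h2 := Complex.norm_exp_sub_one_sub_id_le (x := ((-(‖w‖ ^ 2 / 2) : ℝ) : ℂ))
      (by rw [hz]; linarith)
    rw [hz] at h2
    have h3 : e w - (1 - (‖w‖ ^ 2 : ℝ) / 2) =
        Complex.exp ((-(‖w‖ ^ 2 / 2) : ℝ)) - 1 - ((-(‖w‖ ^ 2 / 2) : ℝ) : ℂ) := by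
      simp only [e]; push_cast; ring
    rw [h3, Real.norm_of_nonneg (sq_nonneg _)]
    have := sq_nonneg ‖w‖
    nlinarith
  have hdiff : (fun w => φ w - e w) =o[𝓝 0] fun w : E => ‖w‖ ^ 2 := by
    simpa using hφ.sub he
  have hprod : Tendsto (fun n => ∏ l, e (v n l)) atTop (𝓝 (Complex.exp (-σ / 2))) := by
    have h1 : ∀ n, ∏ l, e (v n l) = Complex.exp (-((∑ l, ‖v n l‖ ^ 2 : ℝ) : ℂ) / 2) := by
      intro n
      simp only [e]
      rw [← Complex.exp_sum]
      congr 1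
      push_cast
      rw [Finset.sum_neg_distrib, ← Finset.sum_div, neg_div]
    simp only [h1]
    have hc : Continuous fun r : ℝ => Complex.exp (-(r : ℂ) / 2) := by fun_prop
    exact (hc.tendsto σ).comp hσ
  have hzero : Tendsto (fun n => ∏ l, φ (v n l) - ∏ l, e (v n l)) atTop (𝓝 0) := by
    rw [Metric.tendsto_nhds]
    intro r hr
    have hpos : 0 < |σ| + 1 := by positivity
    -- The sums of squares are eventually below `|σ| + 1`, so this constant keeps the total error at
    -- most `r / 2`.
    have hc : 0 < r / (2 * (|σ| + 1)) := by positivity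
    filter_upwards [hv _ (Asymptotics.isLittleO_iff.1 hdiff hc),
      hσ.eventually (gt_mem_nhds (show σ < |σ| + 1 by linarith [le_abs_self σ]))] with n hn hsum
    rw [dist_zero_right]
    calc ‖∏ l, φ (v n l) - ∏ l, e (v n l)‖ ≤ ∑ l, ‖φ (v n l) - e (v n l)‖ :=
          norm_prod_sub_prod_le _ _ _ (fun _ _ => hφ1 _) fun _ _ => he1 _
      _ ≤ ∑ l, r / (2 * (|σ| + 1)) * ‖v n l‖ ^ 2 := by
          refine Finset.sum_le_sum fun l _ => ?_
          have := hn l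
          simpa using this
      _ = r / (2 * (|σ| + 1)) * ∑ l, ‖v n l‖ ^ 2 := by rw [Finset.mul_sum]
      _ ≤ r / (2 * (|σ| + 1)) * (|σ| + 1) := by gcongr
      _ = r / 2 := by field_simp
      _ < r := by linarith
  simpa using hzero.add hprod

end CharFun

/-! ### Central limit theorem for weighted sums, and invariance of the standard normal matrix law.
-/

section CentralLimit

variable {Ω : Type*} [MeasurableSpace Ω] {P : Measure Ω} [IsProbabilityMeasure P]

lemma inner_euclidean {ι : Type*} [Fintype ι] (x y : EuclideanSpace ℝ ι) :
    inner ℝ x y = ∑ b, x b * y b := by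
  simp [PiLp.inner_apply, mul_comm]

lemma continuous_vecRows {s t : ℕ} : Continuous (vecRows (s := s) (t := t)) := by
  unfold vecRows
  fun_prop

/-- The combination `(∑ₐ wₐ u(a,b))_b` of the rows of `u`, regarded as a matrix, with weights `w`. -/
noncomputable def combineRows {s t : ℕ} (u : EuclideanSpace ℝ (Fin s × Fin t)) (w : Fin s → ℝ) :
    EuclideanSpace ℝ (Fin t) :=
  WithLp.toLp 2 fun b => ∑ a, w a * u (a, b)

lemma continuous_combineRows {s t : ℕ} (u : EuclideanSpace ℝ (Fin s × Fin t)) :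
    Continuous (combineRows u) := by
  unfold combineRows
  fun_prop

lemma inner_vecRows_vecMulVec {s t : ℕ} (u : EuclideanSpace ℝ (Fin s × Fin t)) (w : Fin s → ℝ)
    (y : Fin t → ℝ) :
    inner ℝ (vecRows (Matrix.vecMulVec w y)) u =
      inner ℝ (WithLp.toLp 2 y : EuclideanSpace ℝ (Fin t)) (combineRows u w) := by
  rw [inner_euclidean, inner_euclidean, Fintype.sum_prod_type, Finset.sum_comm]
  simp only [vecRows, combineRows, Matrix.vecMulVec_apply, Finset.mul_sum]
  refine Finset.sum_congr rfl fun b _ => Finset.sum_congr rfl fun a _ => ?_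
  ring

/-- The left side is the variance of the projection on `u`; it depends on `W` only through `W W'`,
linearly, so convergence of `W W'` determines its limit. -/
lemma sum_norm_sq_combineRows {s t n : ℕ} (u : EuclideanSpace ℝ (Fin s × Fin t))
    (W : Matrix (Fin s) (Fin n) ℝ) :
    ∑ l, ‖combineRows u (fun a => W a l)‖ ^ 2 =
      ∑ b, ∑ a, ∑ a', u (a, b) * u (a', b) * (W * W.transpose) a a' := by
  simp only [EuclideanSpace.real_norm_sq_eq]
  simp only [combineRows, sq, Finset.sum_mul_sum]
  simp only [Matrix.mul_apply, Matrix.transpose_apply, Finset.mul_sum]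
  rw [Finset.sum_comm]
  refine Finset.sum_congr rfl fun b _ => ?_
  rw [Finset.sum_comm]
  refine Finset.sum_congr rfl fun a _ => ?_
  rw [Finset.sum_comm]
  refine Finset.sum_congr rfl fun a' _ => Finset.sum_congr rfl fun l _ => ?_
  ring

lemma firstRows_mul_eq_sum {s t n : ℕ} (W : Matrix (Fin s) (Fin n) ℝ) (y : ℕ → Fin t → ℝ) :
    vecRows (W * firstRows y n) = ∑ l : Fin n, vecRows (Matrix.vecMulVec (fun a => W a l) (y l)) := by
  ext ab
  simp [vecRows, Matrix.mul_apply, firstRows, Matrix.vecMulVec_apply]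

/-- Central limit theorem for weighted sums `∑ₗ wₗ ηₗ'` of i.i.d. standardized random vectors, with
uniformly negligible weight vectors that are asymptotically normalized. -/
lemma tendstoInDistribution_weighted_sum {s t : ℕ} {η : ℕ → Ω → Fin t → ℝ}
    (hindep : iIndepFun η P) (hident : ∀ l, IdentDistrib (η l) (η 0) P P)
    (hL2 : ∀ a, MemLp (fun ω => η 0 ω a) 2 P) (hmean : ∀ a, ∫ ω, η 0 ω a ∂P = 0)
    (hcov : ∀ a b, ∫ ω, η 0 ω a * η 0 ω b ∂P = (1 : Matrix (Fin t) (Fin t) ℝ) a b)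
    (W : ∀ n : ℕ, Matrix (Fin s) (Fin n) ℝ)
    (hW : Tendsto (fun n => W n * (W n).transpose) atTop (𝓝 1))
    (hneg : ∀ U ∈ 𝓝 (0 : Fin s → ℝ), ∀ᶠ n in atTop, ∀ l, (fun a => W n a l) ∈ U) :
    TendstoInDistribution
      (fun n ω => vecRows (W n * firstRows (fun l => η l ω) n)) atTop
      (id : EuclideanSpace ℝ (Fin s × Fin t) → _) (fun _ => P) (multivariateGaussian 0 1) := by
  have hmeas : ∀ l, AEMeasurable (η l) P := fun l => (hident l).aemeasurable_fst
  have hmeasE : ∀ l, AEMeasurable (fun ω => (WithLp.toLp 2 (η l ω) : EuclideanSpace ℝ (Fin t))) P :=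
    fun l => (WithLp.measurable_toLp 2 (Fin t → ℝ)).comp_aemeasurable (hmeas l)
  have hterm : ∀ (w : Fin s → ℝ), Measurable fun y : Fin t → ℝ =>
      vecRows (Matrix.vecMulVec w y) := fun w =>
    (continuous_vecRows.comp (by fun_prop)).measurable
  have hsum : ∀ n, AEMeasurable (fun ω => vecRows (W n * firstRows (fun l => η l ω) n)) P := by
    intro n
    simp only [firstRows_mul_eq_sum]
    exact Finset.aemeasurable_fun_sum _ fun l _ => (hterm _).comp_aemeasurable (hmeas l)
  set μ : Measure (EuclideanSpace ℝ (Fin t)) := P.map fun ω => WithLp.toLp 2 (η 0 ω) with hμ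
  have : IsProbabilityMeasure μ := Measure.isProbabilityMeasure_map (hmeasE 0)
  have hφ : (fun v => charFun μ v - (1 - (‖v‖ ^ 2 : ℝ) / 2)) =o[𝓝 0] fun v => ‖v‖ ^ 2 := by
    refine charFun_sub_isLittleO μ ?_ (fun v => ?_) fun v => ?_
    · rw [hμ, memLp_map_measure_iff (by fun_prop) (hmeasE 0)]
      exact MemLp.of_eval_piLp hL2
    · rw [hμ, integral_map (hmeasE 0) (by fun_prop)]
      simp only [inner_euclidean]
      rw [integral_finsetSum _ fun a _ => ((hL2 a).integrable (by norm_num)).mul_const _]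
      exact Finset.sum_eq_zero fun a _ => by rw [integral_mul_const, hmean, zero_mul]
    · have hi : ∀ a b, Integrable (fun ω => η 0 ω a * η 0 ω b * (v a * v b)) P := fun a b =>
        ((hL2 a).integrable_mul (hL2 b)).mul_const _
      rw [hμ, integral_map (hmeasE 0) (by fun_prop)]
      have he : ∀ ω, inner ℝ (WithLp.toLp 2 (η 0 ω) : EuclideanSpace ℝ (Fin t)) v ^ 2 =
          ∑ a, ∑ b, η 0 ω a * η 0 ω b * (v a * v b) := fun ω => by
        rw [inner_euclidean, sq, Finset.sum_mul_sum]
        refine Finset.sum_congr rfl fun a _ => Finset.sum_congr rfl fun b _ => ?_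
        ring
      simp only [he]
      rw [integral_finsetSum _ fun a _ => integrable_finsetSum _ fun b _ => hi a b]
      simp only [integral_finsetSum _ fun b _ => hi _ b, integral_mul_const, hcov,
        Matrix.one_apply, ite_mul, one_mul, zero_mul, Finset.sum_ite_eq, Finset.mem_univ, if_true]
      simp only [EuclideanSpace.real_norm_sq_eq]
      simp only [sq]
  -- Lévy's continuity theorem; independence then factors the characteristic function over the rank
  -- one summands.
  refine ⟨hsum, aemeasurable_id, ProbabilityMeasure.tendsto_iff_tendsto_charFun.2 fun u => ?_⟩
  have hchar : ∀ n, charFun (P.map fun ω => vecRows (W n * firstRows (fun l => η l ω) n)) u =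
      ∏ l, charFun μ (combineRows u fun a => W n a l) := by
    intro n
    simp only [firstRows_mul_eq_sum]
    have hind : iIndepFun (fun (l : Fin n) ω =>
        vecRows (Matrix.vecMulVec (fun a => W n a l) (η l ω))) P :=
      (hindep.precomp Fin.val_injective).comp
        (fun l y => vecRows (Matrix.vecMulVec (fun a => W n a l) y)) fun l => hterm _
    refine (congrFun (hind.charFun_map_fun_sum_eq_prod fun l : Fin n =>
      (hterm fun a => W n a l).comp_aemeasurable (hmeas l)) u).trans ?_
    rw [Finset.prod_apply]
    refine Finset.prod_congr rfl fun l _ => ?_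
    have hid := (hident l).comp (hterm fun a => W n a l)
    have hmap := hid.map_eq
    rw [hmap, charFun_apply, charFun_apply, hμ, integral_map (hmeasE 0) (by fun_prop),
      integral_map ((hterm _).comp_aemeasurable (hmeas 0)) (by fun_prop)]
    simp only [Function.comp_apply, inner_vecRows_vecMulVec]
  have hlim := tendsto_prod_of_isLittleO (φ := charFun μ) (fun v => norm_charFun_le_one v) hφ
    (fun n l => combineRows u fun a => W n a l) (fun U hU => by
      have h0 : combineRows u 0 = 0 := by ext b; simp [combineRows]
      exact hneg _ ((continuous_combineRows u).continuousAt (x := 0) (by rwa [h0]))) (σ := ‖u‖ ^ 2)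
    (by
      simp only [sum_norm_sq_combineRows]
      have hc : Continuous fun M : Matrix (Fin s) (Fin s) ℝ =>
          ∑ b, ∑ a, ∑ a', u (a, b) * u (a', b) * M a a' := by fun_prop
      have h1 := (hc.tendsto 1).comp hW
      have h2 : ∑ b, ∑ a, ∑ a', u (a, b) * u (a', b) * (1 : Matrix (Fin s) (Fin s) ℝ) a a' =
          ‖u‖ ^ 2 := by
        rw [EuclideanSpace.real_norm_sq_eq, Fintype.sum_prod_type, Finset.sum_comm]
        simp [Matrix.one_apply, sq]
      rwa [h2] at h1)
  simp only [ProbabilityMeasure.coe_mk, hchar, Measure.map_id, multivariateGaussian_zero_one,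
    charFun_stdGaussian]
  exact_mod_cast hlim

/-- A standard normal matrix multiplied by a matrix with orthonormal columns is again standard
normal. -/
lemma map_vecRows_mul_stdGaussian {s p t : ℕ} {Q : Matrix (Fin p) (Fin t) ℝ}
    (hQ : Q.transpose * Q = 1) :
    (multivariateGaussian 0 1 : Measure (EuclideanSpace ℝ (Fin s × Fin p))).map
      (fun G => vecRows ((Matrix.of fun a b => G (a, b) : Matrix (Fin s) (Fin p) ℝ) * Q)) =
    multivariateGaussian 0 1 := by
  have hcont : Continuous fun G : EuclideanSpace ℝ (Fin s × Fin p) =>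
      vecRows ((Matrix.of fun a b => G (a, b) : Matrix (Fin s) (Fin p) ℝ) * Q) := by
    refine continuous_vecRows.comp (Continuous.matrix_mul ?_ continuous_const)
    exact continuous_matrix fun a b => by simp only [Matrix.of_apply]; fun_prop
  have hp := Measure.isProbabilityMeasure_map (μ := multivariateGaussian 0
    (1 : Matrix (Fin s × Fin p) (Fin s × Fin p) ℝ)) hcont.measurable.aemeasurable
  refine Measure.ext_of_charFun (funext fun u => ?_)
  -- As a matrix `v` is `u Q'`, the image of `u` under the adjoint of right multiplication by `Q`;
  -- `Q'Q = 1` makes this map isometric.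
  let v : EuclideanSpace ℝ (Fin s × Fin p) :=
    WithLp.toLp 2 fun ac => ∑ b, u (ac.1, b) * Q ac.2 b
  have hinner : ∀ G : EuclideanSpace ℝ (Fin s × Fin p),
      inner ℝ (vecRows ((Matrix.of fun a b => G (a, b) : Matrix (Fin s) (Fin p) ℝ) * Q)) u =
        inner ℝ G v := by
    intro G
    simp only [inner_euclidean, Fintype.sum_prod_type, vecRows, v, Matrix.mul_apply,
      Matrix.of_apply, Finset.sum_mul, Finset.mul_sum]
    refine Finset.sum_congr rfl fun a _ => ?_
    rw [Finset.sum_comm]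
    refine Finset.sum_congr rfl fun c _ => Finset.sum_congr rfl fun b _ => ?_
    ring
  have hnorm : ‖v‖ ^ 2 = ‖u‖ ^ 2 := by
    simp only [EuclideanSpace.real_norm_sq_eq, Fintype.sum_prod_type]
    simp only [v, sq, Finset.sum_mul_sum]
    refine Finset.sum_congr rfl fun a _ => ?_
    have h1 : ∀ b b', ∑ c, u (a, b) * Q c b * (u (a, b') * Q c b') =
        u (a, b) * u (a, b') * (Q.transpose * Q) b b' := fun b b' => by
      rw [Matrix.mul_apply, Finset.mul_sum]
      refine Finset.sum_congr rfl fun c _ => ?_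
      rw [Matrix.transpose_apply]; ring
    rw [Finset.sum_comm]
    refine Finset.sum_congr rfl fun b _ => ?_
    rw [Finset.sum_comm]
    simp only [h1, hQ, Matrix.one_apply]
    simp
  have hmain : charFun (multivariateGaussian 0
      (1 : Matrix (Fin s × Fin p) (Fin s × Fin p) ℝ)) v =
      charFun (multivariateGaussian 0 (1 : Matrix (Fin s × Fin t) (Fin s × Fin t) ℝ)) u := by
    rw [multivariateGaussian_zero_one, multivariateGaussian_zero_one, charFun_stdGaussian,
      charFun_stdGaussian]
    congr 2
    exact_mod_cast congrArg (fun r : ℝ => -r) hnorm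
  rw [← hmain, charFun_apply, charFun_apply, integral_map hcont.measurable.aemeasurable
    (by fun_prop)]
  simp only [hinner]

end CentralLimit

/-! ### Asymptotics of the design weights. -/

section DesignAsymptotics

open Matrix
open scoped MatrixOrder

/-- Up to a factor tending to 1, `y l / (l + 1)` is a difference of consecutive averages, so it
tends to 0. This settles `l ≥ L`; the finitely many smaller `l` are absorbed by letting `n` grow. -/
lemma eventually_le_mul_of_tendsto_average {y : ℕ → ℝ} {r : ℝ}
    (h : Tendsto (fun n : ℕ => (n : ℝ)⁻¹ * ∑ l : Fin n, y l) atTop (𝓝 r)) {δ : ℝ} (hδ : 0 < δ) :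
    ∀ᶠ n : ℕ in atTop, ∀ l : Fin n, y l ≤ δ * n := by
  have h1 : Tendsto (fun l : ℕ => ((l + 1 : ℕ) : ℝ)⁻¹ * ∑ i : Fin (l + 1), y i -
      (1 - 1 / ((l : ℝ) + 1)) * ((l : ℝ)⁻¹ * ∑ i : Fin l, y i)) atTop (𝓝 0) := by
    have := (h.comp (tendsto_add_atTop_nat 1)).sub
      
      (((tendsto_const_nhds (x := (1 : ℝ))).sub tendsto_one_div_add_atTop_nhds_zero_nat).mul h)
    simpa using this
  obtain ⟨L, hL⟩ := eventually_atTop.1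
    ((h1.eventually (gt_mem_nhds hδ)).and (eventually_ge_atTop 1))
  have hlarge : ∀ l ≥ L, y l ≤ δ * ((l : ℝ) + 1) := by
    intro l hl
    obtain ⟨h2, h3⟩ := hL l hl
    have hl0 : (0 : ℝ) < l := by exact_mod_cast h3
    rw [Fin.sum_univ_castSucc] at h2
    simp only [Fin.val_castSucc, Fin.val_last] at h2
    push_cast at h2
    have h4 : ((l : ℝ) + 1)⁻¹ * (∑ i : Fin l, y i + y l) -
        (1 - 1 / ((l : ℝ) + 1)) * ((l : ℝ)⁻¹ * ∑ i : Fin l, y i) = y l / ((l : ℝ) + 1) := by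
      field_simp; ring
    rw [h4, div_lt_iff₀ (by positivity)] at h2
    exact h2.le
  have hsmall : ∀ᶠ n : ℕ in atTop, ∀ l ∈ Finset.range L, y l ≤ δ * n := by
    rw [eventually_all_finset]
    exact fun l _ => (tendsto_natCast_atTop_atTop.const_mul_atTop hδ).eventually_ge_atTop (y l)
  filter_upwards [hsmall] with n hn l
  rcases lt_or_ge (l : ℕ) L with hl | hl
  · exact hn l (Finset.mem_range.2 hl)
  · refine (hlarge l hl).trans (mul_le_mul_of_nonneg_left ?_ hδ.le)
    exact_mod_cast l.2

/-- Rows of a design whose normalized Gram matrices converge are uniformly of order `o(√n)`. -/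
lemma eventually_inv_sqrt_smul_mem {d : ℕ} {x : ℕ → Fin d → ℝ} {R : Matrix (Fin d) (Fin d) ℝ}
    (hlim : Tendsto (fun n : ℕ => (n : ℝ)⁻¹ • ((firstRows x n)ᵀ * firstRows x n)) atTop (𝓝 R))
    {U : Set (Fin d → ℝ)} (hU : U ∈ 𝓝 0) :
    ∀ᶠ n : ℕ in atTop, ∀ l : Fin n, (√(n : ℝ))⁻¹ • x l ∈ U := by
  obtain ⟨δ, hδ, hδU⟩ := Metric.mem_nhds_iff.1 hU
  -- The average of the squares of column `c` is a diagonal entry of the normalized Gram matrix. The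
  -- half leaves room for the strict inequality defining the ball.
  have h : ∀ c : Fin d, ∀ᶠ n : ℕ in atTop, ∀ l : Fin n, x l c ^ 2 ≤ (δ / 2) ^ 2 * n := by
    intro c
    refine eventually_le_mul_of_tendsto_average (y := fun l => x l c ^ 2) (r := R c c) ?_
      (by positivity)
    have := (((continuous_apply_apply c c).tendsto R).comp hlim)
    refine this.congr fun n => ?_
    change ((n : ℝ)⁻¹ • ((firstRows x n)ᵀ * firstRows x n)) c c = _
    simp [Matrix.mul_apply, firstRows, sq]
  filter_upwards [eventually_all.2 h, eventually_ge_atTop 1] with n hn hn1 l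
  have hn0 : (0 : ℝ) < n := by exact_mod_cast hn1
  refine hδU ?_
  rw [mem_ball_zero_iff]
  refine lt_of_le_of_lt ((pi_norm_le_iff_of_nonneg (by positivity : (0 : ℝ) ≤ δ / 2)).2
    fun c => ?_) (by linarith)
  rw [Pi.smul_apply, smul_eq_mul, Real.norm_eq_abs, abs_mul, abs_of_nonneg (by positivity),
    inv_mul_le_iff₀ (by positivity), mul_comm]
  have h2 := Real.abs_le_sqrt (hn c l)
  rwa [Real.sqrt_mul (by positivity), Real.sqrt_sq (by positivity)] at h2

lemma tendsto_matrix_mul {α : Type*} {l : Filter α} {a b c : ℕ}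
    {f : α → Matrix (Fin a) (Fin b) ℝ} {g : α → Matrix (Fin b) (Fin c) ℝ}
    {A : Matrix (Fin a) (Fin b) ℝ} {B : Matrix (Fin b) (Fin c) ℝ} (hf : Tendsto f l (𝓝 A))
    (hg : Tendsto g l (𝓝 B)) : Tendsto (fun x => f x * g x) l (𝓝 (A * B)) :=
  ((by fun_prop : Continuous fun y : Matrix (Fin a) (Fin b) ℝ × Matrix (Fin b) (Fin c) ℝ =>
    y.1 * y.2).tendsto (A, B)).comp (hf.prodMk_nhds hg)

lemma inv_smul_of_isUnit {d : ℕ} {c : ℝ} (hc : c ≠ 0) {A : Matrix (Fin d) (Fin d) ℝ}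
    (hA : IsUnit A) : (c • A)⁻¹ = c⁻¹ • A⁻¹ := by
  refine Matrix.inv_eq_right_inv ?_
  rw [Matrix.smul_mul, Matrix.mul_smul, smul_smul, mul_inv_cancel₀ hc, one_smul,
    Matrix.mul_nonsing_inv _ ((Matrix.isUnit_iff_isUnit_det _).1 hA)]

/-- The matrix `√n (C n(X'X)⁻¹ C')^{-1/2} C (X'X)⁻¹ X'` which turns the errors into the
standardized estimation error. -/
noncomputable def designWeights {s d n : ℕ} (C : Matrix (Fin s) (Fin d) ℝ)
    (X : Matrix (Fin n) (Fin d) ℝ) : Matrix (Fin s) (Fin n) ℝ :=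
  √(n : ℝ) • (invSqrt ((n : ℝ) • designForm C X) * C * (Xᵀ * X)⁻¹ * Xᵀ)

section

variable {s d : ℕ} {x : ℕ → Fin d → ℝ} {R : Matrix (Fin d) (Fin d) ℝ}
  {C : Matrix (Fin s) (Fin d) ℝ} {n₀ : ℕ}

lemma tendsto_invSqrt_designForm (hR : R.PosDef)
    (hrank : ∀ n ≥ n₀, (firstRows x n).rank = d)
    (hlim : Tendsto (fun n : ℕ => (n : ℝ)⁻¹ • ((firstRows x n)ᵀ * firstRows x n)) atTop (𝓝 R))
    (hC : Function.Injective (Cᵀ).mulVec) :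
    Tendsto (fun n : ℕ => invSqrt ((n : ℝ) • designForm C (firstRows x n))) atTop
      (𝓝 (invSqrt (C * R⁻¹ * Cᵀ))) := by
  refine (continuousWithinAt_invSqrt (posDef_mul_mul_transpose hC hR.inv)).tendsto.comp
    (tendsto_nhdsWithin_iff.2 ⟨?_, Eventually.of_forall fun n => ?_⟩)
  · have h1 := (continuousAt_inv hR.isUnit).tendsto.comp hlim
    have h2 : Continuous fun M : Matrix (Fin d) (Fin d) ℝ => C * M * Cᵀ := by fun_prop
    refine ((h2.tendsto _).comp h1).congr' ?_
    filter_upwards [eventually_ge_atTop n₀, eventually_ge_atTop 1] with n hn hn1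
    have hn0 : (n : ℝ) ≠ 0 := by positivity
    simp only [Function.comp_apply, designForm]
    rw [inv_smul_of_isUnit (inv_ne_zero hn0) (posDef_transpose_mul_self (hrank n hn)).isUnit,
      inv_inv, Matrix.mul_smul, Matrix.smul_mul]
  · have h1 : ((firstRows x n)ᵀ * firstRows x n).PosSemidef := by
      simpa using Matrix.posSemidef_conjTranspose_mul_self (firstRows x n)
    have h2 : (designForm C (firstRows x n)).PosSemidef := by
      simpa [designForm] using h1.inv.mul_mul_conjTranspose_same C
    exact h2.smul (Nat.cast_nonneg n)

/-- Writing `√n = n / √n` separates a convergent matrix from the transposed design scaled by `1 /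
√n`. -/
lemma designWeights_eq {n : ℕ} (hn : 1 ≤ n) (hrank : (firstRows x n).rank = d) :
    designWeights C (firstRows x n) =
      (invSqrt ((n : ℝ) • designForm C (firstRows x n)) * C *
        ((n : ℝ)⁻¹ • ((firstRows x n)ᵀ * firstRows x n))⁻¹) *
        ((√(n : ℝ))⁻¹ • (firstRows x n)ᵀ) := by
  have hn0 : (0 : ℝ) < n := by exact_mod_cast hn
  rw [inv_smul_of_isUnit (inv_ne_zero hn0.ne') (posDef_transpose_mul_self hrank).isUnit,
    inv_inv, designWeights]
  have hsq : √(n : ℝ) = (√(n : ℝ))⁻¹ * n := by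
    rw [← div_eq_inv_mul, Real.div_sqrt]
  nth_rw 1 [hsq]
  simp only [Matrix.mul_smul, Matrix.smul_mul, smul_smul]

lemma tendsto_designWeights_factor (hR : R.PosDef) (hrank : ∀ n ≥ n₀, (firstRows x n).rank = d)
    (hlim : Tendsto (fun n : ℕ => (n : ℝ)⁻¹ • ((firstRows x n)ᵀ * firstRows x n)) atTop (𝓝 R))
    (hC : Function.Injective (Cᵀ).mulVec) :
    Tendsto (fun n : ℕ => invSqrt ((n : ℝ) • designForm C (firstRows x n)) * C *
        ((n : ℝ)⁻¹ • ((firstRows x n)ᵀ * firstRows x n))⁻¹) atTop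
      (𝓝 (invSqrt (C * R⁻¹ * Cᵀ) * C * R⁻¹)) := by
  have h1 := tendsto_invSqrt_designForm hR hrank hlim hC
  have h2 : Tendsto (fun n : ℕ => ((n : ℝ)⁻¹ • ((firstRows x n)ᵀ * firstRows x n))⁻¹) atTop
      (𝓝 R⁻¹) := (continuousAt_inv hR.isUnit).tendsto.comp hlim
  exact tendsto_matrix_mul (tendsto_matrix_mul h1 tendsto_const_nhds) h2

lemma tendsto_designWeights_mul_transpose (hR : R.PosDef) (hrank : ∀ n ≥ n₀, (firstRows x n).rank = d)
    (hlim : Tendsto (fun n : ℕ => (n : ℝ)⁻¹ • ((firstRows x n)ᵀ * firstRows x n)) atTop (𝓝 R))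
    (hC : Function.Injective (Cᵀ).mulVec) :
    Tendsto (fun n => designWeights C (firstRows x n) * (designWeights C (firstRows x n))ᵀ) atTop
      (𝓝 1) := by
  have h1 := tendsto_designWeights_factor hR hrank hlim hC
  have h3 : Continuous fun M : Matrix (Fin s) (Fin d) ℝ × Matrix (Fin d) (Fin d) ℝ =>
      M.1 * M.2 * M.1ᵀ := by fun_prop
  have h4 := (h3.tendsto (_, R)).comp (h1.prodMk_nhds hlim)
  have h5 : invSqrt (C * R⁻¹ * Cᵀ) * C * R⁻¹ * R * (invSqrt (C * R⁻¹ * Cᵀ) * C * R⁻¹)ᵀ = 1 := by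
    rw [Matrix.transpose_mul, Matrix.transpose_mul, PosDef.transpose_eq hR.inv, transpose_invSqrt,
      Matrix.mul_assoc _ R⁻¹ R, PosDef.inv_mul_self hR, Matrix.mul_one,
      ← invSqrt_mul_mul_invSqrt (posDef_mul_mul_transpose hC hR.inv)]
    simp only [Matrix.mul_assoc]
  simp only [h5] at h4
  refine h4.congr' ?_
  filter_upwards [eventually_ge_atTop n₀, eventually_ge_atTop 1] with n hn hn1
  rw [designWeights_eq hn1 (hrank n hn)]
  have hsq : (√(n : ℝ))⁻¹ * (√(n : ℝ))⁻¹ = (n : ℝ)⁻¹ := by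
    rw [← mul_inv, Real.mul_self_sqrt (Nat.cast_nonneg n)]
  simp only [Function.comp_apply, Matrix.transpose_mul, Matrix.transpose_smul,
    Matrix.transpose_transpose, Matrix.mul_smul, Matrix.smul_mul, smul_smul, hsq,
    Matrix.mul_assoc]

/-- Column `l` is a convergent matrix applied to `x l / √n`, which is small uniformly in `l`; joint
continuity of the product at `(·, 0)` concludes. -/
lemma eventually_designWeights_mem (hR : R.PosDef) (hrank : ∀ n ≥ n₀, (firstRows x n).rank = d)
    (hlim : Tendsto (fun n : ℕ => (n : ℝ)⁻¹ • ((firstRows x n)ᵀ * firstRows x n)) atTop (𝓝 R))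
    (hC : Function.Injective (Cᵀ).mulVec) {U : Set (Fin s → ℝ)} (hU : U ∈ 𝓝 0) :
    ∀ᶠ n in atTop, ∀ l, (fun a => designWeights C (firstRows x n) a l) ∈ U := by
  have h1 := tendsto_designWeights_factor hR hrank hlim hC
  have h2 : Continuous fun M : Matrix (Fin s) (Fin d) ℝ × (Fin d → ℝ) => M.1 *ᵥ M.2 := by fun_prop
  have h3 : (fun M : Matrix (Fin s) (Fin d) ℝ × (Fin d → ℝ) => M.1 *ᵥ M.2) ⁻¹' U ∈
      𝓝 (invSqrt (C * R⁻¹ * Cᵀ) * C * R⁻¹, (0 : Fin d → ℝ)) :=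
    h2.continuousAt (by simpa using hU)
  obtain ⟨A, hA, B, hB, hAB⟩ := mem_nhds_prod_iff.1 h3
  filter_upwards [h1 hA, eventually_inv_sqrt_smul_mem hlim hB, eventually_ge_atTop n₀,
    eventually_ge_atTop 1] with n hnA hnB hn hn1 l
  obtain ⟨M, hM, hMA⟩ : ∃ M, invSqrt ((n : ℝ) • designForm C (firstRows x n)) * C *
    ((n : ℝ)⁻¹ • ((firstRows x n)ᵀ * firstRows x n))⁻¹ = M ∧ M ∈ A := ⟨_, rfl, hnA⟩
  rw [designWeights_eq hn1 (hrank n hn), hM]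
  have hmem : M *ᵥ ((√(n : ℝ))⁻¹ • x l) ∈ U := hAB (Set.mk_mem_prod hMA (hnB l))
  exact hmem

end

end DesignAsymptotics

/-! ### Consistency of the covariance estimator. -/

section Consistency

open Matrix
open scoped MatrixOrder

variable {Ω : Type*} [MeasurableSpace Ω] {P : Measure Ω} [IsProbabilityMeasure P]

lemma tendstoInProb_normalized_gram {p : ℕ} {ε : ℕ → Ω → Fin p → ℝ}
    {S : Matrix (Fin p) (Fin p) ℝ} (hindep : iIndepFun ε P)
    (hident : ∀ l, IdentDistrib (ε l) (ε 0) P P) (hL2 : ∀ a, MemLp (fun ω => ε 0 ω a) 2 P)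
    (hcov : ∀ a b, ∫ ω, ε 0 ω a * ε 0 ω b ∂P = S a b) :
    TendstoInProb P (fun n ω => (n : ℝ)⁻¹ •
      ((firstRows (fun l => ε l ω) n)ᵀ * firstRows (fun l => ε l ω) n)) S := by
  refine TendstoInProb.matrix fun a b => ?_
  have hm : Measurable fun y : Fin p → ℝ => y a * y b := by fun_prop
  have h := tendstoInProb_average (P := P) (ξ := fun l ω => ε l ω a * ε l ω b)
    (hindep.comp (fun _ y => y a * y b) fun _ => hm) (fun l => (hident l).comp hm)
    ((hL2 a).integrable_mul (hL2 b))
  rw [hcov] at h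
  convert h using 3
  simp [Matrix.mul_apply, firstRows]

/-- The weights `x l c / n` have sum of squares `n⁻¹` times a convergent diagonal entry of the
normalized Gram matrix. -/
lemma tendstoInProb_normalized_cross {p d : ℕ} {ε : ℕ → Ω → Fin p → ℝ} (hindep : iIndepFun ε P)
    (hident : ∀ l, IdentDistrib (ε l) (ε 0) P P) (hL2 : ∀ a, MemLp (fun ω => ε 0 ω a) 2 P)
    (hmean : ∀ a, ∫ ω, ε 0 ω a ∂P = 0) {x : ℕ → Fin d → ℝ} {R : Matrix (Fin d) (Fin d) ℝ}
    (hlim : Tendsto (fun n : ℕ => (n : ℝ)⁻¹ • ((firstRows x n)ᵀ * firstRows x n)) atTop (𝓝 R)) :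
    TendstoInProb P (fun n ω => (n : ℝ)⁻¹ • ((firstRows x n)ᵀ * firstRows (fun l => ε l ω) n))
      0 := by
  refine TendstoInProb.matrix fun c b => ?_
  have hm : Measurable fun y : Fin p → ℝ => y b := by fun_prop
  have h := tendstoInProb_weighted_sum (P := P) (ξ := fun l ω => ε l ω b)
    (hindep.comp (fun _ y => y b) fun _ => hm) (fun l => (hident l).comp hm) (hL2 b) (hmean b)
    (fun n l => (n : ℝ)⁻¹ * x l c) (by
      have h1 : Tendsto (fun n : ℕ => ((n : ℝ)⁻¹ • ((firstRows x n)ᵀ * firstRows x n)) c c) atTop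
          (𝓝 (R c c)) := ((continuous_apply_apply c c).tendsto R).comp hlim
      have h2 := (tendsto_inv_atTop_nhds_zero_nat (𝕜 := ℝ)).mul h1
      rw [zero_mul] at h2
      refine h2.congr fun n => ?_
      simp only [Matrix.smul_apply, Matrix.mul_apply, firstRows, Matrix.transpose_apply,
        Matrix.of_apply, smul_eq_mul, Finset.mul_sum]
      refine Finset.sum_congr rfl fun l _ => ?_
      ring)
  convert h using 3
  · simp [Matrix.mul_apply, firstRows, Finset.mul_sum, mul_assoc]
  · rfl

variable {k p : ℕ} {m : Fin k → ℕ}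

lemma covEstimator_eq_normalized {n : ℕ} {X : ∀ j, Matrix (Fin n) (Fin (m j)) ℝ}
    (hX : IsOrthogonalDesign p X) (hn : 1 ≤ n) (E : Matrix (Fin n) (Fin p) ℝ) :
    covEstimator X E = (((n : ℝ) - ∑ j, (m j : ℝ))⁻¹ * n) •
      ((n : ℝ)⁻¹ • (Eᵀ * E) - ∑ j, ((n : ℝ)⁻¹ • ((X j)ᵀ * E))ᵀ * ((n : ℝ)⁻¹ • ((X j)ᵀ * X j))⁻¹ *
        ((n : ℝ)⁻¹ • ((X j)ᵀ * E))) := by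
  have hn0 : (n : ℝ) ≠ 0 := by positivity
  rw [covEstimator_eq_sub]
  simp only [hX.rank_eq]
  rw [mul_smul]
  congr 1
  rw [smul_sub, smul_smul, mul_inv_cancel₀ hn0, one_smul, Finset.smul_sum]
  congr 1
  refine Finset.sum_congr rfl fun j _ => ?_
  rw [inv_smul_of_isUnit (inv_ne_zero hn0) (posDef_transpose_mul_self (hX.rank_eq j)).isUnit,
    inv_inv, Matrix.transpose_smul]
  simp only [Matrix.smul_mul, Matrix.mul_smul, smul_smul]
  rw [mul_inv_cancel₀ hn0, mul_one, mul_inv_cancel₀ hn0, one_smul]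

lemma tendstoInProb_covEstimator {x : ∀ j : Fin k, ℕ → Fin (m j) → ℝ} {n₀ : ℕ}
    (hX : ∀ n ≥ n₀, IsOrthogonalDesign p fun j => firstRows (x j) n)
    {ε : ℕ → Ω → Fin p → ℝ}
    {S : Matrix (Fin p) (Fin p) ℝ} (hindep : iIndepFun ε P)
    (hident : ∀ l, IdentDistrib (ε l) (ε 0) P P) (hL2 : ∀ a, MemLp (fun ω => ε 0 ω a) 2 P)
    (hmean : ∀ a, ∫ ω, ε 0 ω a ∂P = 0) (hcov : ∀ a b, ∫ ω, ε 0 ω a * ε 0 ω b ∂P = S a b)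
    {R : ∀ j : Fin k, Matrix (Fin (m j)) (Fin (m j)) ℝ} (hR : ∀ j, (R j).PosDef)
    (hlim : ∀ j, Tendsto (fun n : ℕ => (n : ℝ)⁻¹ •
      ((firstRows (x j) n)ᵀ * firstRows (x j) n)) atTop (𝓝 (R j))) :
    TendstoInProb P (fun n ω => covEstimator (fun j => firstRows (x j) n)
      (firstRows (fun l => ε l ω) n)) S := by
  -- The estimator is `F` at normalized moments with limit `(1, S, 0, R)`; the correction is
  -- quadratic in the cross moments and vanishes there.
  let F : ℝ × Matrix (Fin p) (Fin p) ℝ × (∀ j, Matrix (Fin (m j)) (Fin p) ℝ) ×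
      (∀ j, Matrix (Fin (m j)) (Fin (m j)) ℝ) → Matrix (Fin p) (Fin p) ℝ :=
    fun y => y.1 • (y.2.1 - ∑ j, (y.2.2.1 j)ᵀ * (y.2.2.2 j)⁻¹ * y.2.2.1 j)
  have hF : ContinuousAt F (1, S, 0, R) := by
    have hinv : ∀ j, ContinuousAt (fun y : ℝ × Matrix (Fin p) (Fin p) ℝ ×
        (∀ j, Matrix (Fin (m j)) (Fin p) ℝ) × (∀ j, Matrix (Fin (m j)) (Fin (m j)) ℝ) =>
        (y.2.2.2 j)⁻¹) (1, S, 0, R) := fun j =>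
      ContinuousAt.comp (g := fun M : Matrix (Fin (m j)) (Fin (m j)) ℝ => M⁻¹)
        (continuousAt_inv (hR j).isUnit) (Continuous.continuousAt (by fun_prop))
    refine ContinuousAt.smul continuousAt_fst (ContinuousAt.sub
      (Continuous.continuousAt (by fun_prop)) (tendsto_finsetSum _ fun j _ => ?_))
    have h1 : Continuous fun y : ℝ × Matrix (Fin p) (Fin p) ℝ ×
        (∀ j, Matrix (Fin (m j)) (Fin p) ℝ) × (∀ j, Matrix (Fin (m j)) (Fin (m j)) ℝ) =>
        y.2.2.1 j := by fun_prop
    exact tendsto_matrix_mul (tendsto_matrix_mul (h1.matrix_transpose.tendsto _) (hinv j))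
      (h1.tendsto _)
  have hc : Tendsto (fun n : ℕ => ((n : ℝ) - ∑ j, (m j : ℝ))⁻¹ * n) atTop (𝓝 1) := by
    have h1 : Tendsto (fun n : ℕ => (1 - (∑ j, (m j : ℝ)) * (n : ℝ)⁻¹)⁻¹) atTop (𝓝 1) := by
      have := ((tendsto_inv_atTop_nhds_zero_nat (𝕜 := ℝ)).const_mul (∑ j, (m j : ℝ))).const_sub 1
      simpa using this.inv₀ (by simp)
    refine h1.congr' ?_
    filter_upwards [eventually_ge_atTop 1] with n hn
    have hn0 : (n : ℝ) ≠ 0 := by positivity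
    have : 1 - (∑ j, (m j : ℝ)) * (n : ℝ)⁻¹ = ((n : ℝ) - ∑ j, (m j : ℝ)) * (n : ℝ)⁻¹ := by
      rw [sub_mul, mul_inv_cancel₀ hn0]
    rw [this, mul_inv, inv_inv]
  have hlim' : Tendsto (fun (n : ℕ) (j : Fin k) => (n : ℝ)⁻¹ •
      ((firstRows (x j) n)ᵀ * firstRows (x j) n)) atTop (𝓝 R) := tendsto_pi_nhds.2 hlim
  have hcross : TendstoInProb P (fun n ω (j : Fin k) => (n : ℝ)⁻¹ •
      ((firstRows (x j) n)ᵀ * firstRows (fun l => ε l ω) n)) 0 :=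
    TendstoInProb.pi fun j => tendstoInProb_normalized_cross hindep hident hL2 hmean (hlim j)
  have hall := ((TendstoInProb.of_tendsto (P := P) hc).prodMk
    ((tendstoInProb_normalized_gram hindep hident hL2 hcov).prodMk
      (hcross.prodMk (TendstoInProb.of_tendsto hlim')))).comp_continuousAt hF
  have hFS : F (1, S, 0, R) = S := by simp [F]
  rw [hFS] at hall
  refine hall.congr' (tendsto_const_nhds.congr' ?_)
  filter_upwards [eventually_ge_atTop n₀, eventually_ge_atTop 1] with n hn hn1
  symm
  exact measure_mono_null (t := ∅)
    (fun ω hω => hω (covEstimator_eq_normalized (hX n hn) hn1 _).symm) measure_empty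

/-- For large `n` the estimate is always positive semidefinite, so it fails to be positive definite
only if singular, and the invertible matrices form a neighbourhood of `S`. -/
lemma tendsto_measure_not_posDef {P : Measure Ω} {x : ∀ j : Fin k, ℕ → Fin (m j) → ℝ} {n₀ : ℕ}
    (hX : ∀ n ≥ n₀, IsOrthogonalDesign p fun j => firstRows (x j) n)
    {ε : ℕ → Ω → Fin p → ℝ} {S : Matrix (Fin p) (Fin p) ℝ} (hS : S.PosDef)
    (h : TendstoInProb P (fun n ω => covEstimator (fun j => firstRows (x j) n)
      (firstRows (fun l => ε l ω) n)) S) :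
    Tendsto (fun n => P {ω | covEstimator (fun j => firstRows (x j) n)
      (firstRows (fun l => ε l ω) n) ∉ {A | A.PosDef}}) atTop (𝓝 0) := by
  refine (h _ (isOpen_isUnit.mem_nhds hS.isUnit)).congr' ?_
  filter_upwards [eventually_ge_atTop n₀, eventually_ge_atTop (∑ j, m j)] with n hn hn1
  congr 1
  ext ω
  have := (posSemidef_covEstimator (hX n hn) hn1 (firstRows (fun l => ε l ω) n)).posDef_iff_isUnit
  simp [this]

end Consistency

/-! ### The right-hand factor of the statistic. -/

section ProfileFactor

open Matrix
open scoped MatrixOrder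

variable {p q t : ℕ}

/-- The factor `S^{1/2} A⁻¹ Z (Z' A⁻¹ Z)⁻¹ V' (V (Z' A⁻¹ Z)⁻¹ V')^{-1/2}` by which the standardized
errors are multiplied, set to zero where `A` is not positive definite. -/
noncomputable def profileFactor (V : Matrix (Fin t) (Fin q) ℝ) (Z : Matrix (Fin p) (Fin q) ℝ)
    (S A : Matrix (Fin p) (Fin p) ℝ) : Matrix (Fin p) (Fin t) ℝ :=
  CFC.sqrt S * A⁻¹ * Z * (Zᵀ * A⁻¹ * Z)⁻¹ * Vᵀ * invSqrt (profileForm V Z A)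

variable {V : Matrix (Fin t) (Fin q) ℝ} {Z : Matrix (Fin p) (Fin q) ℝ}
  {S : Matrix (Fin p) (Fin p) ℝ}

lemma measurable_profileFactor : Measurable (profileFactor V Z S) := by
  have hc : ∀ {a b : ℕ} (M : Matrix (Fin a) (Fin b) ℝ),
    Measurable fun _ : Matrix (Fin p) (Fin p) ℝ => M := fun M => measurable_const
  have hi : Measurable fun A : Matrix (Fin p) (Fin p) ℝ => (Zᵀ * A⁻¹ * Z)⁻¹ :=
    measurable_inv.comp (measurable_matrix_mul (measurable_matrix_mul (hc _) measurable_inv) (hc _))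
  have hp : Measurable fun A : Matrix (Fin p) (Fin p) ℝ => invSqrt (profileForm V Z A) :=
    measurable_invSqrt.comp (measurable_matrix_mul (measurable_matrix_mul (hc _) hi) (hc _))
  exact measurable_matrix_mul (measurable_matrix_mul (measurable_matrix_mul (measurable_matrix_mul
    (measurable_matrix_mul (hc _) measurable_inv) (hc _)) hi) (hc _)) hp

lemma posDef_profileForm (hZ : Z.rank = q) (hV : Function.Injective (Vᵀ).mulVec)
    (hS : S.PosDef) : (profileForm V Z S).PosDef :=
  posDef_mul_mul_transpose hV (posDef_transpose_mul_mul hZ hS.inv).inv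

lemma continuousWithinAt_profileFactor (hZ : Z.rank = q) (hV : Function.Injective (Vᵀ).mulVec)
    (hS : S.PosDef) : ContinuousWithinAt (profileFactor V Z S) {A | A.PosDef} S := by
  have hinv : Tendsto (fun A : Matrix (Fin p) (Fin p) ℝ => A⁻¹) (𝓝[{A | A.PosDef}] S) (𝓝 S⁻¹) :=
    (continuousAt_inv hS.isUnit).continuousWithinAt
  have hi : Tendsto (fun A : Matrix (Fin p) (Fin p) ℝ => (Zᵀ * A⁻¹ * Z)⁻¹)
      (𝓝[{A | A.PosDef}] S) (𝓝 (Zᵀ * S⁻¹ * Z)⁻¹) :=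
    (continuousAt_inv (posDef_transpose_mul_mul hZ hS.inv).isUnit).tendsto.comp
      (tendsto_matrix_mul (tendsto_matrix_mul tendsto_const_nhds hinv) tendsto_const_nhds)
  have hform : Tendsto (profileForm V Z) (𝓝[{A | A.PosDef}] S) (𝓝 (profileForm V Z S)) :=
    tendsto_matrix_mul (tendsto_matrix_mul tendsto_const_nhds hi) tendsto_const_nhds
  have hp : Tendsto (fun A => invSqrt (profileForm V Z A)) (𝓝[{A | A.PosDef}] S)
      (𝓝 (invSqrt (profileForm V Z S))) := by
    refine (continuousWithinAt_invSqrt (posDef_profileForm hZ hV hS)).tendsto.comp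
      (tendsto_nhdsWithin_iff.2 ⟨hform, ?_⟩)
    filter_upwards [eventually_mem_nhdsWithin] with A hA
    exact (posDef_profileForm hZ hV hA).posSemidef
  exact tendsto_matrix_mul (tendsto_matrix_mul (tendsto_matrix_mul (tendsto_matrix_mul
    (tendsto_matrix_mul tendsto_const_nhds hinv) tendsto_const_nhds) hi) tendsto_const_nhds) hp

/-- At the true covariance the inner products collapse to `V (Z' S⁻¹ Z)⁻¹ V'`, which the outer
inverse roots normalize. -/
lemma transpose_profileFactor_mul_self (hZ : Z.rank = q) (hV : Function.Injective (Vᵀ).mulVec)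
    (hS : S.PosDef) : (profileFactor V Z S S)ᵀ * profileFactor V Z S S = 1 := by
  have hH := posDef_transpose_mul_mul hZ hS.inv
  have h1 : S⁻¹ * (CFC.sqrt S * CFC.sqrt S) * S⁻¹ = S⁻¹ := by
    rw [sqrt_mul_sqrt hS.posSemidef, PosDef.inv_mul_self hS, Matrix.one_mul]
  calc (profileFactor V Z S S)ᵀ * profileFactor V Z S S
      = invSqrt (profileForm V Z S) * (V * ((Zᵀ * S⁻¹ * Z)⁻¹ *
          (Zᵀ * (S⁻¹ * (CFC.sqrt S * CFC.sqrt S) * S⁻¹) * Z) * (Zᵀ * S⁻¹ * Z)⁻¹) * Vᵀ) *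
          invSqrt (profileForm V Z S) := by
        simp only [profileFactor, Matrix.transpose_mul, transpose_invSqrt, transpose_sqrt,
          Matrix.transpose_transpose, PosDef.transpose_eq hS.inv, PosDef.transpose_eq hH.inv]
        simp only [Matrix.mul_assoc]
    _ = invSqrt (profileForm V Z S) * profileForm V Z S * invSqrt (profileForm V Z S) := by
        rw [h1, PosDef.inv_mul_self hH, Matrix.one_mul, profileForm]
    _ = 1 := invSqrt_mul_mul_invSqrt (posDef_profileForm hZ hV hS)

end ProfileFactor

/-! ### Exact factorization of the statistic under the hypothesis. -/

section Representation

open Matrix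
open scoped MatrixOrder Classical

variable {k n p s t : ℕ} {m q : Fin k → ℕ}
  {X : ∀ j, Matrix (Fin n) (Fin (m j)) ℝ} {Z : ∀ j, Matrix (Fin p) (Fin (q j)) ℝ}

/-- Under the hypothesis `C Θᵢ V' = 0` the standardized statistic is the product of a weighted sum
of standardized errors and of a factor depending on the covariance estimate alone. -/
lemma standardizedStatistic_eq (hX : IsOrthogonalDesign p X) (hZ : ∀ j, (Z j).rank = q j)
    (Θ : ∀ j, Matrix (Fin (m j)) (Fin (q j)) ℝ) (E : Matrix (Fin n) (Fin p) ℝ) (i : Fin k)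
    (C : Matrix (Fin s) (Fin (m i)) ℝ) (V : Matrix (Fin t) (Fin (q i)) ℝ)
    (hH : C * Θ i * Vᵀ = 0) {S : Matrix (Fin p) (Fin p) ℝ} (hS : S.PosDef) :
    standardizedStatistic X Z i C V (meanStructure X Z Θ + E) =
      designWeights C (X i) * (E * invSqrt S) *
        (if (covEstimator X E).PosDef then profileFactor V (Z i) S (covEstimator X E) else 0) := by
  have hcov := covEstimator_meanStructure_add (Z := Z) hX Θ E
  split_ifs with hA
  · have hgls := twoStageGLS_of_posDef hX hZ (Y := meanStructure X Z Θ + E) (by rwa [hcov])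
    rw [hcov] at hgls
    rw [standardizedStatistic, hgls, hcov]
    set A := covEstimator X E
    have hG := PosDef.inv_mul_self (posDef_transpose_mul_self (hX.rank_eq i))
    have hB := PosDef.mul_inv_self (posDef_transpose_mul_mul (hZ i) hA.inv)
    have hsqrt : invSqrt S * CFC.sqrt S = 1 :=
      Matrix.nonsing_inv_mul _ ((Matrix.isUnit_iff_isUnit_det _).1 (isUnit_sqrt hS))
    have hest : C * glsEstimate X Z A (meanStructure X Z Θ + E) i * Vᵀ =
        C * ((X i)ᵀ * X i)⁻¹ * (X i)ᵀ * E * A⁻¹ * Z i * ((Z i)ᵀ * A⁻¹ * Z i)⁻¹ * Vᵀ := by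
      -- The contribution of the mean to the estimate: both Gram factors cancel, leaving `C Θᵢ V' =
      -- 0`.
      have h1 : C * (((X i)ᵀ * X i)⁻¹ * ((X i)ᵀ * meanStructure X Z Θ) * A⁻¹ * Z i *
          ((Z i)ᵀ * A⁻¹ * Z i)⁻¹) * Vᵀ = 0 := by
        rw [transpose_mul_meanStructure hX]
        calc _ = C * ((((X i)ᵀ * X i)⁻¹ * ((X i)ᵀ * X i)) * Θ i *
              (((Z i)ᵀ * A⁻¹ * Z i) * ((Z i)ᵀ * A⁻¹ * Z i)⁻¹)) * Vᵀ := by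
              simp only [Matrix.mul_assoc]
          _ = 0 := by rw [hG, hB, Matrix.one_mul, Matrix.mul_one, hH]
      refine Eq.trans ?_ (zero_add _)
      rw [← h1]
      simp only [glsEstimate, Matrix.mul_add, Matrix.add_mul, Matrix.mul_assoc]
    rw [hest, designWeights, profileFactor]
    simp only [Matrix.smul_mul, Matrix.mul_smul, Matrix.mul_assoc]
    rw [← Matrix.mul_assoc (invSqrt S), hsqrt, Matrix.one_mul]
  -- Both sides vanish, the estimator being 0 by default here.
  · rw [standardizedStatistic, twoStageGLS_of_not_posDef (by rwa [hcov])]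
    simp

end Representation

/-! ### Passing to a shifted index. -/

section Limit

/-- Convergence in distribution includes measurability at every index, whereas the factorization is
known only from `n₀` on; hence the sequence is started there. -/
lemma tendstoInDistribution_shift {Ω Ω' E : Type*} [MeasurableSpace Ω] [MeasurableSpace Ω']
    {P : Measure Ω} [IsProbabilityMeasure P] {P' : Measure Ω'} [IsProbabilityMeasure P']
    [TopologicalSpace E] [MeasurableSpace E] [OpensMeasurableSpace E] {X : ℕ → Ω → E} {Z : Ω' → E}
    (h : TendstoInDistribution X atTop Z (fun _ => P) P') {μ : Measure E} [IsProbabilityMeasure μ]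
    (hμ : P'.map Z = μ) (n₀ : ℕ) {T : ℕ → Ω → E} (hT : ∀ n ω, T n ω = X (n₀ + n) ω) :
    TendstoInDistribution T atTop (id : E → E) (fun _ => P) μ := by
  obtain rfl : T = fun n => X (n₀ + n) := funext fun n => funext fun ω => hT n ω
  refine ⟨fun n => h.forall_aemeasurable _, aemeasurable_id, ?_⟩
  have h1 := h.tendsto.comp ((tendsto_add_atTop_nat n₀).congr fun n => add_comm n n₀)
  subst hμ
  simp only [Measure.map_id]
  exact h1

end Limit

/-! ### The limit of the standardized errors, and the conclusion. -/

section Main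

open Matrix
open scoped MatrixOrder Classical

variable {Ω : Type*} [MeasurableSpace Ω] {P : Measure Ω} [IsProbabilityMeasure P]

lemma aemeasurable_firstRows {P : Measure Ω} {p : ℕ} {ε : ℕ → Ω → Fin p → ℝ} (h : ∀ l, AEMeasurable (ε l) P)
    (n : ℕ) : AEMeasurable (fun ω => firstRows (fun l => ε l ω) n) P :=
  aemeasurable_pi_lambda _ fun l => h l

lemma measurable_covEstimator {n k p : ℕ} {m : Fin k → ℕ}
    (X : ∀ j, Matrix (Fin n) (Fin (m j)) ℝ) : Measurable (covEstimator (p := p) X) := by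
  unfold covEstimator
  exact Continuous.measurable (by fun_prop)

/-- Central limit theorem for the standardized errors `√n (C n(X'X)⁻¹ C')^{-1/2} C (X'X)⁻¹ X' E S^{-1/2}`. -/
lemma tendstoInDistribution_designWeights {p s d : ℕ} {ε : ℕ → Ω → Fin p → ℝ}
    {S : Matrix (Fin p) (Fin p) ℝ} (hS : S.PosDef) (hindep : iIndepFun ε P)
    (hident : ∀ l, IdentDistrib (ε l) (ε 0) P P) (hL2 : ∀ a, MemLp (fun ω => ε 0 ω a) 2 P)
    (hmean : ∀ a, ∫ ω, ε 0 ω a ∂P = 0) (hcov : ∀ a b, ∫ ω, ε 0 ω a * ε 0 ω b ∂P = S a b)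
    {x : ℕ → Fin d → ℝ} {R : Matrix (Fin d) (Fin d) ℝ} {C : Matrix (Fin s) (Fin d) ℝ} {n₀ : ℕ}
    (hR : R.PosDef) (hrank : ∀ n ≥ n₀, (firstRows x n).rank = d)
    (hlim : Tendsto (fun n : ℕ => (n : ℝ)⁻¹ • ((firstRows x n)ᵀ * firstRows x n)) atTop (𝓝 R))
    (hC : Function.Injective (Cᵀ).mulVec) :
    TendstoInDistribution (fun n ω => vecRows (designWeights C (firstRows x n) *
      (firstRows (fun l => ε l ω) n * invSqrt S))) atTop
      (id : EuclideanSpace ℝ (Fin s × Fin p) → _) (fun _ => P) (multivariateGaussian 0 1) := by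
  have hm : Measurable fun y : Fin p → ℝ => y ᵥ* invSqrt S :=
    Continuous.measurable (by fun_prop)
  have happ : ∀ ω a, (ε 0 ω ᵥ* invSqrt S) a = ∑ c, ε 0 ω c * invSqrt S c a := fun ω a => rfl
  have hi : ∀ c e r, Integrable (fun ω => ε 0 ω c * ε 0 ω e * r) P := fun c e r =>
    ((hL2 c).integrable_mul (hL2 e)).mul_const r
  -- Whitening: the rows `εₗ' S^{-1/2}` have covariance `S^{-1/2} S S^{-1/2} = 1`.
  refine tendstoInDistribution_weighted_sum (η := fun l ω => ε l ω ᵥ* invSqrt S)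
    (hindep.comp (fun _ y => y ᵥ* invSqrt S) fun _ => hm) (fun l => (hident l).comp hm)
    (fun a => ?_) (fun a => ?_) (fun a b => ?_) _
    (tendsto_designWeights_mul_transpose hR hrank hlim hC)
    fun U hU => eventually_designWeights_mem hR hrank hlim hC hU
  · simp only [happ]
    exact memLp_finsetSum _ fun c _ => (hL2 c).mul_const _
  · simp only [happ]
    rw [integral_finsetSum _ fun c _ => ((hL2 c).integrable (by norm_num)).mul_const _]
    exact Finset.sum_eq_zero fun c _ => by rw [integral_mul_const, hmean, zero_mul]
  · have he : ∀ ω, (ε 0 ω ᵥ* invSqrt S) a * (ε 0 ω ᵥ* invSqrt S) b =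
        ∑ c, ∑ e, ε 0 ω c * ε 0 ω e * (invSqrt S c a * invSqrt S e b) := fun ω => by
      rw [happ, happ, Finset.sum_mul_sum]
      refine Finset.sum_congr rfl fun c _ => Finset.sum_congr rfl fun e _ => ?_
      ring
    simp only [he]
    rw [integral_finsetSum _ fun c _ => integrable_finsetSum _ fun e _ => hi c e _]
    simp only [integral_finsetSum _ fun e _ => hi _ e _, integral_mul_const, hcov]
    rw [← invSqrt_mul_mul_invSqrt hS, Matrix.mul_assoc, Matrix.mul_apply]
    refine Finset.sum_congr rfl fun c _ => ?_
    rw [Matrix.mul_apply, Finset.mul_sum]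
    refine Finset.sum_congr rfl fun e _ => ?_
    have hsym : invSqrt S a c = invSqrt S c a := by
      conv_lhs => rw [← transpose_invSqrt S]
      rfl
    rw [hsym]; ring

/-- Multiplication of matrices, in terms of the vectors of their entries. -/
noncomputable def vecMul {s p t : ℕ}
    (y : EuclideanSpace ℝ (Fin s × Fin p) × EuclideanSpace ℝ (Fin p × Fin t)) :
    EuclideanSpace ℝ (Fin s × Fin t) :=
  vecRows ((Matrix.of fun a b => y.1 (a, b) : Matrix (Fin s) (Fin p) ℝ) *
    (Matrix.of fun a b => y.2 (a, b) : Matrix (Fin p) (Fin t) ℝ))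

lemma continuous_vecMul {s p t : ℕ} : Continuous (vecMul (s := s) (p := p) (t := t)) := by
  refine continuous_vecRows.comp (Continuous.matrix_mul ?_ ?_) <;>
  exact continuous_matrix fun a b => by simp only [Matrix.of_apply]; fun_prop

lemma vecMul_vecRows {s p t : ℕ} (A : Matrix (Fin s) (Fin p) ℝ) (B : Matrix (Fin p) (Fin t) ℝ) :
    vecMul (vecRows A, vecRows B) = vecRows (A * B) := rfl

end Main

end GrowthCurve

theorem corollary4p1
    {Ω : Type*} [MeasurableSpace Ω] (P : Measure Ω) [IsProbabilityMeasure P]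
    {k p : ℕ} {m q : Fin k → ℕ}
    -- row `l` of the `j`-th design matrix is `x j l`; `Z j` is the `j`-th profile matrix
    (x : ∀ j : Fin k, ℕ → Fin (m j) → ℝ)
    (Z : ∀ j : Fin k, Matrix (Fin p) (Fin (q j)) ℝ)
    (Θ : ∀ j : Fin k, Matrix (Fin (m j)) (Fin (q j)) ℝ)
    (hZ : ∀ j, (Z j).rank = q j)
    (n₀ : ℕ)
    (hX : ∀ n ≥ n₀, GrowthCurve.IsOrthogonalDesign p fun j => GrowthCurve.firstRows (x j) n)
    -- the rows of the error matrix: i.i.d. with mean zero and covariance matrix `S`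
    (ε : ℕ → Ω → Fin p → ℝ)
    (S : Matrix (Fin p) (Fin p) ℝ) (hS : S.PosDef)
    (hindep : iIndepFun ε P)
    (hident : ∀ l, IdentDistrib (ε l) (ε 0) P P)
    (hL2 : ∀ a, MemLp (fun ω => ε 0 ω a) 2 P)
    (hmean : ∀ a, ∫ ω, ε 0 ω a ∂P = 0)
    (hcov : ∀ a b, ∫ ω, ε 0 ω a * ε 0 ω b ∂P = S a b)
    -- the observations follow the additive growth curve model
    (Y : ∀ n : ℕ, Ω → Matrix (Fin n) (Fin p) ℝ)
    (hY : ∀ n ω, Y n ω =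
      GrowthCurve.meanStructure (fun j => GrowthCurve.firstRows (x j) n) Z Θ +
        GrowthCurve.firstRows (fun l => ε l ω) n)
    -- `n⁻¹ Xⱼ'Xⱼ` converges to a positive definite matrix
    (R : ∀ j : Fin k, Matrix (Fin (m j)) (Fin (m j)) ℝ)
    (hR : ∀ j, (R j).PosDef)
    (hlim : ∀ j, Tendsto (fun n : ℕ => (n : ℝ)⁻¹ •
      ((GrowthCurve.firstRows (x j) n).transpose * GrowthCurve.firstRows (x j) n))
      atTop (𝓝 (R j)))
    -- the hypothesis `C Θᵢ V' = 0` and the nonsingularity conditions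
    (i : Fin k) {s t : ℕ}
    (C : Matrix (Fin s) (Fin (m i)) ℝ) (V : Matrix (Fin t) (Fin (q i)) ℝ)
    (hC : ∀ n ≥ n₀, IsUnit (GrowthCurve.designForm C (GrowthCurve.firstRows (x i) n)))
    (hV : Tendsto (fun n : ℕ => P {ω | IsUnit (GrowthCurve.profileForm V (Z i)
      (GrowthCurve.covEstimator (fun j => GrowthCurve.firstRows (x j) n) (Y n ω)))})
      atTop (𝓝 1))
    (hH : C * Θ i * V.transpose = 0) :
    TendstoInDistribution
      (fun (n : ℕ) (ω : Ω) => GrowthCurve.vecRows (GrowthCurve.standardizedStatistic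
        (fun j => GrowthCurve.firstRows (x j) (n₀ + n)) Z i C V (Y (n₀ + n) ω)))
      atTop
      (id : EuclideanSpace ℝ (Fin s × Fin t) → EuclideanSpace ℝ (Fin s × Fin t))
      (fun _ => P) (multivariateGaussian 0 1) := by
  classical
  have hCinj : Function.Injective C.transpose.mulVec :=
    GrowthCurve.transpose_mulVec_injective_of_isUnit (hC n₀ le_rfl)
  have hVinj : Function.Injective V.transpose.mulVec := by
    -- One outcome at one sample size suffices: injectivity of `V'` is deterministic.
    obtain ⟨n, hn⟩ := (hV.eventually (lt_mem_nhds one_pos)).exists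
    obtain ⟨ω, hω⟩ := nonempty_of_measure_ne_zero hn.ne'
    exact GrowthCurve.transpose_mulVec_injective_of_isUnit hω
  have hcons := GrowthCurve.tendstoInProb_covEstimator hX hindep hident hL2 hmean hcov hR hlim
  have hnot := GrowthCurve.tendsto_measure_not_posDef hX hS hcons
  have hclt := GrowthCurve.tendstoInDistribution_designWeights hS hindep hident hL2 hmean hcov
    (hR i) (fun n hn => (hX n hn).rank_eq i) (hlim i) hCinj
  let A : ℕ → Ω → Matrix (Fin p) (Fin p) ℝ := fun n ω => GrowthCurve.covEstimator
    (fun j => GrowthCurve.firstRows (x j) n) (GrowthCurve.firstRows (fun l => ε l ω) n)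
  let Q : Matrix (Fin p) (Fin p) ℝ → Matrix (Fin p) (Fin t) ℝ := fun M =>
    if M.PosDef then GrowthCurve.profileFactor V (Z i) S M else 0
  have hQmeas : Measurable Q :=
    Measurable.ite GrowthCurve.measurableSet_posDef GrowthCurve.measurable_profileFactor
      measurable_const
  have hQ : GrowthCurve.TendstoInProb P (fun n ω => Q (A n ω))
      (GrowthCurve.profileFactor V (Z i) S S) := by
    refine (hcons.comp_continuousWithinAt
      (GrowthCurve.continuousWithinAt_profileFactor (hZ i) hVinj hS) hnot).congr' ?_
    refine tendsto_of_tendsto_of_tendsto_of_le_of_le tendsto_const_nhds hnot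
      (fun _ => zero_le) fun n => measure_mono fun ω hω hpd => hω ?_
    exact (if_pos hpd).symm
  have hQvec := (hQ.comp_continuousAt (g := GrowthCurve.vecRows)
    GrowthCurve.continuous_vecRows.continuousAt).tendstoInMeasure
  have hQae : ∀ n, AEMeasurable (fun ω => GrowthCurve.vecRows (Q (A n ω))) P := fun n =>
    (GrowthCurve.continuous_vecRows.measurable.comp (hQmeas.comp
      (GrowthCurve.measurable_covEstimator _))).comp_aemeasurable
      (GrowthCurve.aemeasurable_firstRows (fun l => (hident l).aemeasurable_fst) n)
  -- Slutsky's theorem, the second factor having a constant limit.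
  have hslutsky := hclt.continuous_comp_prodMk_of_tendstoInMeasure_const
    (GrowthCurve.continuous_vecMul (s := s) (p := p) (t := t)) hQvec hQae
  refine GrowthCurve.tendstoInDistribution_shift hslutsky
    (GrowthCurve.map_vecRows_mul_stdGaussian
      (GrowthCurve.transpose_profileFactor_mul_self (hZ i) hVinj hS)) n₀ fun n ω => ?_
  rw [GrowthCurve.vecMul_vecRows, hY, GrowthCurve.standardizedStatistic_eq
    (hX (n₀ + n) (Nat.le_add_right _ _)) hZ Θ _ i C V hH hS]
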